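/- **Setting.** Let $\mathcal X,\mathcal Y$ be separable real Hilbert spaces, $n\ge 1$, $\sigma>0$, $G_0:\mathcal X\to\mathcal Y$ Borel measurable, and fix design points $\pmb x=(x_1,\dots,x_n)\in\mathcal X^n$. The data are $y_i=G_0(x_i)+\sigma\varepsilon_i$, $i=1,\dots,n$, under one of two noise models: * *White noise*: $\varepsilon_1,\dots,\varepsilon_n$ are independent $\mathcal Y$-white noise processes, i.e. centred Gaussian processes $(\varepsilon_i(f))_{f\in\mathcal Y}$ with $\mathrm{Cov}(\varepsilon_i(f),\varepsilon_i(f'))=\langle f,f'\rangle_{\mathcal Y}$. One writes $\langle \varepsilon_i,f\rangle:=\varepsilon_i(f)$ and $\langle y_i,f\rangle:=\langle G_0(x_i),f\rangle_{\mathcal Y}+\sigma\varepsilon_i(f)$. * *Sub-Gaussian noise*: $\varepsilon_1,\dots,\varepsilon_n$ are independent $\mathcal Y$-valued random vectors with $\mathbb E[\varepsilon_i]=0$ and $\mathbb P(\|\varepsilon_i\|_{\mathcal Y}\ge t)\le 2\exp(-t^2/2)$ for all $t\ge 0$. Write $\mathbb P^{\pmb x}_{G_0}$ for the probability under this model with fixed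 $\pmb x$. For $G:\mathcal X\to\mathcal Y$ put $\|G\|_n^2=\frac1n\sum_{i=1}^n\|G(x_i)\|_{\mathcal Y}^2$ and $$I_n(G)=\frac1n\sum_{i=1}^n\bigl(-2\langle y_i,G(x_i)\rangle+\|G(x_i)\|_{\mathcal Y}^2\bigr).$$ For a pseudometric space $(T,d)$ let $N(T,d,\rho)$ be the minimal number of open $d$-balls of radius $\rho$ (with centres in $T$) that cover $T$, and $H(T,d,\rho)=\log N(T,d,\rho)$. Let $\pmb G$ be a class of measurable maps $\mathcal X\to\mathcal Y$ and $G^*\in\pmb G$. For $\delta>0$ put $\pmb G_n^*(\delta)=\{G\in\pmb G:\|G-G^*\|_n\le\delta\}$ and $J(\delta)=\int_0^\delta H(\pmb G_n^*(\delta),\|\cdot\|_n,\rho)^{1/2}\,d\rho$. **Assumptions.** (a) $\pmb G$ is contained in a linear space of maps $\mathcal X\to\mathcal Y$ that carries a norm $\|\cdot\|$ with $\|\cdot\|_n\le A\|\cdot\|$ for some constant $A>0$, and $\pmb G$ is compact with respect to $\|\cdot\|$. (b) $\Psi_n:(0,\infty)\to[0,\infty)$ satisfies $\Psi_n(\delta)\ge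 J(\delta)$ for all $\delta>0$, and $\delta\mapsto\Psi_n(\delta)/\delta^2$ is non-increasing on $(0,\infty)$. **Theorem.** There is a universal constant $C_{\rm ch}>0$ such that in every such setting the following holds. (i) In the white noise model there is a version (modification) of $(\varepsilon_1,\dots,\varepsilon_n)$, again a family of independent $\mathcal Y$-white noise processes, whose sample paths are continuous on $\pmb G$, i.e. for every outcome and every $i$ the map $G\mapsto\langle\varepsilon_i,G(x_i)\rangle$ is continuous on $(\pmb G,\|\cdot\|)$. In the sub-Gaussian noise model, and in the white noise model for every version with sample paths continuous on $\pmb G$, minimizers of $I_n$ over $\pmb G$ exist, and there is a selection $\hat G_n$ of minimizers that is measurable with respect to the $\sigma$-algebra generated by the data $y_1,\dots,y_n$ (and the Borel $\sigma$-algebra of $\|\cdot\|$). (ii) Let $\hat G_n$ be any measurable selection of ($\mathbb P^{\pmb x}_{G_0}$-almost sure) minimizers of $I_n$ over $\pmb G$, where in the white noise model the sample paths are almost surely continuous on $\pmb G$. Then for every $\delta_n>0$ with $$\sqrt n\,\delta_n^2\ge 32\,C_{\rm ch}\,\sigma\,\Psi_n(\delta_n)$$ and every $R\ge\max\bigl\{\delta_n,\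 4C_{\rm ch}\sigma/\sqrt n,\ \sqrt2\,\|G^*-G_0\|_n\bigr\}$, $$\mathbb P^{\pmb x}_{G_0}\bigl(\|\hat G_n-G_0\|_n\ge R\bigr)\le 2\exp\Bigl(-\frac{nR^2}{16\,C_{\rm ch}^2\sigma^2}\Bigr).$$ -/

import Mathlib

open MeasureTheory ProbabilityTheory Set
open scoped ENNReal RealInnerProductSpace

noncomputable section

namespace HilbertRegression

/-- The covering number of `T` for the pseudometric `d`: the least number of open `d`-balls of
radius `ρ`, with centres in `T`, that cover `T` (`⊤` if there is no finite cover). -/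
def coveringNumber {α : Type*} (T : Set α) (d : α → α → ℝ) (ρ : ℝ) : ℕ∞ :=
  ⨅ (F : Finset α) (_ : (F : Set α) ⊆ T) (_ : ∀ t ∈ T, ∃ s ∈ F, d t s < ρ), (F.card : ℕ∞)

/-- The metric entropy `H(T, d, ρ) = log N(T, d, ρ)`, with `log ⊤ = ⊤`. -/
def metricEntropy {α : Type*} (T : Set α) (d : α → α → ℝ) (ρ : ℝ) : ℝ≥0∞ :=
  (ENNReal.log (coveringNumber T d ρ : ℝ≥0∞)).toENNReal

variable {X Y : Type*} [NormedAddCommGroup Y] [InnerProductSpace ℝ Y] {n : ℕ}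

/-- The empirical seminorm `‖G‖ₙ = ((1/n) ∑ ‖G(xᵢ)‖²)^{1/2}` of the design `x`. -/
def empNorm (x : Fin n → X) (G : X → Y) : ℝ :=
  √((1 / (n : ℝ)) * ∑ i, ‖G (x i)‖ ^ 2)

/-- The localized class `{G ∈ 𝒢 : ‖G - Gs‖ₙ ≤ δ}`. -/
def localClass (x : Fin n → X) (𝒢 : Set (X → Y)) (Gs : X → Y) (δ : ℝ) : Set (X → Y) :=
  {G | G ∈ 𝒢 ∧ empNorm x (G - Gs) ≤ δ}

/-- The entropy integral `J(δ) = ∫₀^δ H(𝒢ₙ*(δ), ‖·‖ₙ, ρ)^{1/2} dρ`, with values in `[0, ∞]`. -/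
def entropyIntegral (x : Fin n → X) (𝒢 : Set (X → Y)) (Gs : X → Y) (δ : ℝ) : ℝ≥0∞ :=
  ∫⁻ ρ in Ioc 0 δ,
    metricEntropy (localClass x 𝒢 Gs δ) (fun G G' => empNorm x (G - G')) ρ ^ (1 / 2 : ℝ)

/-- The observations `yᵢ = G₀(xᵢ) + σ εᵢ`, as processes indexed by `Y`:
`yᵢ(f) = ⟨G₀(xᵢ), f⟩ + σ εᵢ(f)`. -/
def observation (x : Fin n → X) (G₀ : X → Y) (σ : ℝ) (ε : Fin n → Y → ℝ) : Fin n → Y → ℝ :=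
  fun i f => ⟪G₀ (x i), f⟫ + σ * ε i f

/-- The empirical risk `Iₙ(G) = (1/n) ∑ (-2 ⟨G(xᵢ), yᵢ⟩ + ‖G(xᵢ)‖²)`, where `⟨f, yᵢ⟩` is the
value `yᵢ(f)` of the `i`-th observation. -/
def empRisk (x : Fin n → X) (y : Fin n → Y → ℝ) (G : X → Y) : ℝ :=
  (1 / (n : ℝ)) * ∑ i, (-2 * y i (G (x i)) + ‖G (x i)‖ ^ 2)

/-- The `σ`-algebra on `Ω` generated by all `yᵢ(f)`, `i ≤ n`, `f ∈ Y`. -/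
abbrev dataSigma {Ω : Type*} (y : Ω → Fin n → Y → ℝ) : MeasurableSpace Ω :=
  MeasurableSpace.comap y MeasurableSpace.pi

/-- The sample `w` of the noise is continuous on the class `ι '' K`, with respect to the norm of
`E`: for every `i` the map `G ↦ ⟨wᵢ, G(xᵢ)⟩` is continuous. -/
def ContinuousOnClass {E : Type*} [NormedAddCommGroup E] [NormedSpace ℝ E]
    (x : Fin n → X) (ι : E →ₗ[ℝ] (X → Y)) (K : Set E) (w : Fin n → Y → ℝ) : Prop :=
  ∀ i, ContinuousOn (fun g : E => w i (ι g (x i))) K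

/-- A `Y`-white noise process: a centred Gaussian process indexed by `Y` with covariance
`Cov(W(f), W(f')) = ⟨f, f'⟩`. -/
structure IsWhiteNoise {Ω : Type*} [MeasurableSpace Ω] (W : Ω → Y → ℝ) (P : Measure Ω) :
    Prop where
  measurable : ∀ f, Measurable fun ω => W ω f
  gaussian : IsGaussianProcess (fun (f : Y) (ω : Ω) => W ω f) P
  mean : ∀ f, ∫ ω, W ω f ∂P = 0
  cov : ∀ f f', covariance (fun ω => W ω f) (fun ω => W ω f') P = ⟪f, f'⟫

/-- The white noise model: `ε₁, …, εₙ` are independent `Y`-white noise processes. -/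
structure IsWhiteNoiseModel {Ω : Type*} [MeasurableSpace Ω] (ε : Ω → Fin n → Y → ℝ)
    (P : Measure Ω) : Prop where
  whiteNoise : ∀ i, IsWhiteNoise (fun ω => ε ω i) P
  indep : iIndepFun (fun i ω => ε ω i) P

/-- A `Y`-valued random vector `e` is sub-Gaussian with parameter `η`: it is centred and
`P(‖e‖ ≥ t) ≤ 2 exp(-t²/(2η²))` for all `t ≥ 0`. -/
structure IsSubGaussian {Ω : Type*} [MeasurableSpace Ω] [MeasurableSpace Y]
    (e : Ω → Y) (η : ℝ) (P : Measure Ω) : Prop where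
  measurable : Measurable e
  mean : ∫ ω, e ω ∂P = 0
  tail : ∀ t : ℝ, 0 ≤ t → P.real {ω | t ≤ ‖e ω‖} ≤ 2 * Real.exp (-t ^ 2 / (2 * η ^ 2))

/-- The sub-Gaussian noise model: `εᵢ(f) = ⟨eᵢ, f⟩` with independent `Y`-valued random vectors
`e₁, …, eₙ` that are sub-Gaussian with parameter `1`. -/
def IsSubGaussianModel {Ω : Type*} [MeasurableSpace Ω] [MeasurableSpace Y]
    (ε : Ω → Fin n → Y → ℝ) (P : Measure Ω) : Prop :=
  ∃ e : Fin n → Ω → Y, (∀ i, IsSubGaussian (e i) 1 P) ∧ iIndepFun e P ∧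
    ∀ ω i f, ε ω i f = ⟪e i ω, f⟫

end HilbertRegression

end

open HilbertRegression

/-! Comparing the risk of a minimizer `Ĝ` with that of `G*` gives `basic_inequality`: `n (‖Ĝ - G₀‖ₙ²
- ‖G* - G₀‖ₙ²)` is at most `2σ` times the noise increment between `Ĝ` and `G*`. If `‖Ĝ - G₀‖ₙ` lies
in a shell `[r, 2r)` with `r = 2 ^ s * R`, then `R ≥ √2 ‖G* - G₀‖ₙ` makes the left side at least `n
r² / 2` and places `Ĝ` in the localized class of radius `3r`. So some noise increment in that class
is at least `n r² / (4σ)`, and a deviation inequality for each shell, summed over `s`, gives the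
concentration bound.

The deviation inequality is Dudley's chaining. In both noise models, the noise divided by `4√n` has
sub-Gaussian increments for `‖·‖ₙ`, by Gaussianity or by an exponential square moment of `‖εᵢ‖`. Off
an event of probability `exp (-t²)`, the increments along the links of a dyadic net sum to at most a
constant times `J + δ t + δ`. Path continuity and separability of `K` reduce the supremum to a
countable one. Monotonicity of `Ψ δ / δ²` carries the condition at `δₙ` to all larger radii.

The same chain, with Borel–Cantelli, gives uniform continuity of white noise on countable sets,
hence a continuous version. For the selection, the compact class is parametrized by the Cantor set;
the least minimizing parameter is measurable. -/

noncomputable section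

namespace HilbertRegression

open Filter Topology
open scoped NNReal

/-! ### Chaining for processes with sub-Gaussian increments -/

section Chaining

variable {α Ω : Type*}

/-- A symmetric function that satisfies the triangle inequality. -/
structure IsPseudoDist (d : α → α → ℝ) : Prop where
  symm : ∀ s t, d s t = d t s
  triangle : ∀ r s t, d r t ≤ d r s + d s t

/-- Finite nets `N k ⊆ T` of radius `δ 2⁻ᵏ` and cardinality at most `exp (h k)`, such that the
entropy sum `∑ δ 2⁻ᵏ √(h k)` is bounded by `J`. -/
structure IsDyadicNet (T : Set α) (d : α → α → ℝ) (δ J : ℝ) (N : ℕ → Finset α) (h : ℕ → ℝ) :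
    Prop where
  pos : 0 < δ
  subset : ∀ k, (N k : Set α) ⊆ T
  cover : ∀ k, ∀ t ∈ T, ∃ s ∈ N k, d t s ≤ δ * (1 / 2) ^ k
  card_le : ∀ k, ((N k).card : ℝ) ≤ Real.exp (h k)
  nonneg : ∀ k, 0 ≤ h k
  mono : Monotone h
  sum_le : ∀ m, ∑ k ∈ Finset.range m, δ * (1 / 2) ^ k * √(h k) ≤ J

theorem coveringNumber_anti (T : Set α) (d : α → α → ℝ) : Antitone (coveringNumber T d) := by
  intro a b hab
  unfold coveringNumber
  refine le_iInf fun F => le_iInf fun hF => le_iInf fun hc => ?_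
  refine iInf_le_of_le F (iInf_le_of_le hF (iInf_le_of_le (fun t ht => ?_) le_rfl))
  obtain ⟨s, hs, hd⟩ := hc t ht
  exact ⟨s, hs, hd.trans_le hab⟩

theorem metricEntropy_anti (T : Set α) (d : α → α → ℝ) : Antitone (metricEntropy T d) := by
  intro a b hab
  refine EReal.toENNReal_le_toENNReal (ENNReal.log_le_log ?_)
  exact_mod_cast coveringNumber_anti T d hab

/-- A finite metric entropy is realized by a finite net. -/
theorem exists_finset_of_metricEntropy_ne_top {T : Set α} {d : α → α → ℝ} {ρ : ℝ}
    (h : metricEntropy T d ρ ≠ ⊤) :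
    ∃ F : Finset α, (F : Set α) ⊆ T ∧ (∀ t ∈ T, ∃ s ∈ F, d t s < ρ) ∧
      (F.card : ℝ) ≤ Real.exp (metricEntropy T d ρ).toReal := by
  have hfin : coveringNumber T d ρ ≠ ⊤ := by
    intro htop
    apply h
    simp [metricEntropy, htop]
  obtain ⟨m, hm⟩ := ENat.ne_top_iff_exists.1 hfin
  have hlt : coveringNumber T d ρ < ((m + 1 : ℕ) : ℕ∞) := by
    rw [← hm]; exact_mod_cast Nat.lt_succ_self m
  unfold coveringNumber at hlt
  simp only [iInf_lt_iff] at hlt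
  obtain ⟨F, hF, hc, hcard⟩ := hlt
  have hcard' : F.card ≤ m := by
    have : F.card < m + 1 := by exact_mod_cast hcard
    omega
  refine ⟨F, hF, hc, ?_⟩
  -- If `m = 0` the net is empty; the truncation of `log 0 = -∞` to `0` does no harm.
  rcases Nat.eq_zero_or_pos m with h0 | h0
  · have : F.card = 0 := by omega
    rw [this]; simpa using (Real.exp_pos _).le
  have hm0 : (0 : ℝ) < m := by exact_mod_cast h0
  have hH : (metricEntropy T d ρ).toReal = Real.log m := by
    have hcast : ((m : ℕ∞) : ℝ≥0∞) = ENNReal.ofReal (m : ℝ) := by simp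
    have hlog : 0 ≤ Real.log m := Real.log_nonneg (by exact_mod_cast h0)
    rw [metricEntropy, ← hm, hcast, ENNReal.log_ofReal_of_pos hm0, EReal.toENNReal_of_ne_top
      (EReal.coe_ne_top _), EReal.toReal_coe, ENNReal.toReal_ofReal hlog]
  rw [hH, Real.exp_log hm0]
  exact_mod_cast hcard'

/-- The dyadic entropy sum is bounded by the entropy integral. -/
theorem tsum_dyadic_le_lintegral {f : ℝ → ℝ≥0∞} (hf : Antitone f) {δ : ℝ} (hδ : 0 < δ) :
    ∑' k : ℕ, ENNReal.ofReal (δ * (1 / 2) ^ (k + 2)) * f (δ * (1 / 2) ^ (k + 1)) ≤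
      ∫⁻ ρ in Ioc 0 δ, f ρ := by
  set ρ : ℕ → ℝ := fun k => δ * (1 / 2) ^ (k + 1) with hρ
  have hanti : Antitone ρ := by
    intro a b hab
    exact mul_le_mul_of_nonneg_left
      (pow_le_pow_of_le_one (by norm_num) (by norm_num) (by omega)) hδ.le
  have hdisj : Pairwise (Function.onFun Disjoint fun k => Ioc (ρ (k + 1)) (ρ k)) :=
    hanti.pairwise_disjoint_on_Ioc_succ
  calc ∑' k : ℕ, ENNReal.ofReal (δ * (1 / 2) ^ (k + 2)) * f (δ * (1 / 2) ^ (k + 1))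
      ≤ ∑' k : ℕ, ∫⁻ r in Ioc (ρ (k + 1)) (ρ k), f r := by
        refine ENNReal.tsum_le_tsum fun k => ?_
        have h1 : ∫⁻ _ in Ioc (ρ (k + 1)) (ρ k), f (ρ k) ≤
            ∫⁻ r in Ioc (ρ (k + 1)) (ρ k), f r :=
          setLIntegral_mono' measurableSet_Ioc fun r hr => hf hr.2
        refine le_trans (le_of_eq ?_) h1
        rw [setLIntegral_const, Real.volume_Ioc, mul_comm]
        congr 2
        simp only [hρ]
        ring
    _ = ∫⁻ r in ⋃ k, Ioc (ρ (k + 1)) (ρ k), f r :=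
        (lintegral_iUnion (fun _ => measurableSet_Ioc) hdisj f).symm
    _ ≤ ∫⁻ r in Ioc 0 δ, f r := by
        refine lintegral_mono_set (iUnion_subset fun k r hr => ⟨?_, ?_⟩)
        · exact lt_trans (by simp only [hρ]; positivity) hr.1
        · refine hr.2.trans ?_
          simp only [hρ]
          exact mul_le_of_le_one_right hδ.le (pow_le_one₀ (by norm_num) (by norm_num))

/-- A finite entropy integral provides dyadic nets whose coarsest member is a single point. -/
theorem exists_isDyadicNet {T : Set α} {d : α → α → ℝ} {δ J : ℝ} {t₀ : α} (hδ : 0 < δ)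
    (hJ : 0 ≤ J) (ht₀ : t₀ ∈ T) (hrad : ∀ t ∈ T, d t t₀ ≤ δ)
    (hint : ∫⁻ ρ in Ioc 0 δ, metricEntropy T d ρ ^ (1 / 2 : ℝ) ≤ ENNReal.ofReal J) :
    ∃ N h, IsDyadicNet T d δ (2 * J) N h ∧ N 0 = {t₀} := by
  set H : ℕ → ℝ≥0∞ := fun k => metricEntropy T d (δ * (1 / 2) ^ k) with hH
  have hsum : ∑' k : ℕ, ENNReal.ofReal (δ * (1 / 2) ^ (k + 2)) * H (k + 1) ^ (1 / 2 : ℝ) ≤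
      ENNReal.ofReal J :=
    (tsum_dyadic_le_lintegral
      (fun a b hab => ENNReal.rpow_le_rpow (metricEntropy_anti T d hab) (by norm_num)) hδ).trans
      hint
  have hfin : ∀ k, H (k + 1) ≠ ⊤ := by
    intro k htop
    have h1 := (ENNReal.le_tsum k).trans hsum
    rw [htop, ENNReal.top_rpow_of_pos (by norm_num), ENNReal.mul_top] at h1
    · exact ENNReal.ofReal_ne_top (top_le_iff.1 h1)
    · have : 0 < δ * (1 / 2 : ℝ) ^ (k + 2) := by positivity
      exact (ENNReal.ofReal_pos.2 this).ne'
  choose F hFsub hFcov hFcard using fun k => exists_finset_of_metricEntropy_ne_top (hfin k)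
  -- Level `0` is the centre alone, with `h 0 = 0`; no entropy at radius `δ` itself is needed.
  let N : ℕ → Finset α := fun k => Nat.casesOn k {t₀} F
  let h : ℕ → ℝ := fun k => Nat.casesOn k 0 fun j => (H (j + 1)).toReal
  refine ⟨N, h, ⟨hδ, ?_, ?_, ?_, ?_, ?_, ?_⟩, rfl⟩
  · rintro (_ | k)
    · simpa [N] using ht₀
    · exact hFsub k
  · rintro (_ | k) t ht
    · exact ⟨t₀, by simp [N], by simpa using hrad t ht⟩
    · obtain ⟨s, hs, hd⟩ := hFcov k t ht
      exact ⟨s, hs, hd.le⟩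
  · rintro (_ | k)
    · simp [N, h]
    · exact hFcard k
  · rintro (_ | k)
    · exact le_rfl
    · exact ENNReal.toReal_nonneg
  · refine monotone_nat_of_le_succ ?_
    rintro (_ | k)
    · exact ENNReal.toReal_nonneg
    · refine ENNReal.toReal_mono (hfin _) (metricEntropy_anti T d ?_)
      exact mul_le_mul_of_nonneg_left
        (pow_le_pow_of_le_one (by norm_num) (by norm_num) (by omega)) hδ.le
  · intro m
    have hterm : ∀ k, ENNReal.ofReal (δ * (1 / 2) ^ (k + 2)) * H (k + 1) ^ (1 / 2 : ℝ) =
        ENNReal.ofReal (δ * (1 / 2) ^ (k + 2) * √(h (k + 1))) := by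
      intro k
      rw [ENNReal.ofReal_mul (p := δ * (1 / 2) ^ (k + 2)) (by positivity)]
      congr 1
      change _ = ENNReal.ofReal √(H (k + 1)).toReal
      rw [Real.sqrt_eq_rpow, ← ENNReal.ofReal_rpow_of_nonneg ENNReal.toReal_nonneg (by norm_num),
        ENNReal.ofReal_toReal (hfin k)]
    simp_rw [hterm] at hsum
    have hpart : ∀ m, ∑ k ∈ Finset.range m, δ * (1 / 2) ^ (k + 2) * √(h (k + 1)) ≤ J := by
      intro m
      have h1 := (ENNReal.sum_le_tsum (Finset.range m)).trans hsum
      rw [← ENNReal.ofReal_sum_of_nonneg (fun k _ => by positivity)] at h1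
      exact (ENNReal.ofReal_le_ofReal_iff hJ).1 h1
    rcases m with _ | m
    · simpa using hJ
    rw [Finset.sum_range_succ']
    have h0 : √(h 0) = 0 := by simp [h]
    rw [h0, mul_zero, add_zero]
    -- The dyadic interval below a radius is half as long as the radius; this is the factor `2` in
    -- `2 * J`.
    have h2 : ∑ k ∈ Finset.range m, δ * (1 / 2) ^ (k + 1) * √(h (k + 1)) =
        2 * ∑ k ∈ Finset.range m, δ * (1 / 2) ^ (k + 2) * √(h (k + 1)) := by
      rw [Finset.mul_sum]
      refine Finset.sum_congr rfl fun k _ => ?_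
      ring
    rw [h2]
    linarith [hpart m]

/-- The bound on the increments along the `k`-th link of the chain, at deviation level `x`. -/
def linkBound (δ : ℝ) (h : ℕ → ℝ) (x : ℝ) (k : ℕ) : ℝ :=
  3 * (δ * (1 / 2) ^ k) * (2 * √(h (k + 1)) + 2 * x + 2 * (k + 1))

/-- The event that some increment along the `k`-th link exceeds its bound. -/
def badEvent (Z : α → Ω → ℝ) (d : α → α → ℝ) (δ : ℝ) (N : ℕ → Finset α) (h : ℕ → ℝ) (x : ℝ)
    (k : ℕ) : Set Ω :=
  {ω | ∃ s ∈ N (k + 1), ∃ t, (t ∈ N k ∨ t ∈ N (k + 1)) ∧ d s t ≤ 3 * (δ * (1 / 2) ^ k) ∧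
    linkBound δ h x k < |Z s ω - Z t ω|}

variable {Z : α → Ω → ℝ} {T : Set α} {d : α → α → ℝ} {δ J x : ℝ} {N : ℕ → Finset α} {h : ℕ → ℝ}

theorem linkBound_nonneg (hδ : 0 ≤ δ) (hx : 0 ≤ x) (k : ℕ) : 0 ≤ linkBound δ h x k := by
  unfold linkBound; positivity

/-- Telescoping: consecutive projections of `t` are within `(1 + 1 / 2) δ 2⁻ᵏ`, so each step is a
link controlled off the bad event. -/
theorem abs_chain_le (hd : IsPseudoDist d) (hN : IsDyadicNet T d δ J N h) {t : α} {p : ℕ → α}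
    (hp : ∀ k, p k ∈ N k ∧ d t (p k) ≤ δ * (1 / 2) ^ k) {ω : Ω} {m : ℕ}
    (hω : ∀ k, m ≤ k → ω ∉ badEvent Z d δ N h x k) (j : ℕ) :
    |Z (p (m + j)) ω - Z (p m) ω| ≤ ∑ k ∈ Finset.range j, linkBound δ h x (m + k) := by
  have hδ := hN.pos
  induction j with
  | zero => simp
  | succ j ih =>
    have hstep : |Z (p (m + j + 1)) ω - Z (p (m + j)) ω| ≤ linkBound δ h x (m + j) := by
      by_contra! hlt
      refine hω (m + j) (by omega) ⟨p (m + j + 1), (hp _).1, p (m + j), Or.inl (hp _).1, ?_, hlt⟩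
      have h1 := hd.triangle (p (m + j + 1)) t (p (m + j))
      have h2 := (hp (m + j + 1)).2
      have h3 := (hp (m + j)).2
      rw [hd.symm (p (m + j + 1)) t] at h1
      rw [pow_succ] at h2
      have : 0 < δ * (1 / 2) ^ (m + j) := by positivity
      linarith
    rw [Finset.sum_range_succ]
    have := abs_sub_le (Z (p (m + j + 1)) ω) (Z (p (m + j)) ω) (Z (p m) ω)
    rw [← add_assoc]
    linarith

variable [MeasurableSpace Ω] {P : Measure Ω}

/-- The increments of `Z` on `T` have sub-Gaussian tails, on the scale of the distance `d`. -/
def HasSubgaussianIncrements (Z : α → Ω → ℝ) (T : Set α) (d : α → α → ℝ) (P : Measure Ω) : Prop :=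
  ∀ s ∈ T, ∀ t ∈ T, ∀ r : ℝ, 0 < r → d s t ≤ r → ∀ u : ℝ, 0 ≤ u →
    P {ω | u ≤ |Z s ω - Z t ω|} ≤ ENNReal.ofReal (2 * Real.exp (-u ^ 2 / (2 * r ^ 2)))

/-- Union bound over at most `2 exp (2 h (k + 1))` pairs. The three terms of `linkBound` pay, in
order, for the number of pairs, for the factor `exp (-x²)` and for summability in `k`. Since `exp
(-2) ≤ 1 / 5`, the bounds over all `k` add up to exactly `exp (-x²)`. -/
theorem measure_badEvent_le (hZ : HasSubgaussianIncrements Z T d P)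
    (hN : IsDyadicNet T d δ J N h) (hx : 0 ≤ x) (k : ℕ) :
    P (badEvent Z d δ N h x k) ≤ ENNReal.ofReal (4 * (1 / 5) ^ (k + 1) * Real.exp (-x ^ 2)) := by
  classical
  have hδ := hN.pos
  set r : ℝ := 3 * (δ * (1 / 2) ^ k) with hr
  have hr0 : 0 < r := by positivity
  set v : ℝ := 2 * √(h (k + 1)) + 2 * x + 2 * (k + 1) with hv
  have hlink : linkBound δ h x k = r * v := rfl
  have hv0 : 0 ≤ v := by positivity
  have hv2 : 2 * h (k + 1) + x ^ 2 + 2 * (k + 1) ≤ v ^ 2 / 2 := by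
    have h1 := Real.sq_sqrt (hN.nonneg (k + 1))
    have h2 := Real.sqrt_nonneg (h (k + 1))
    have hk : (0 : ℝ) ≤ k := k.cast_nonneg
    have h3 : 0 ≤ √(h (k + 1)) * x := by positivity
    have h4 : 0 ≤ √(h (k + 1)) * (k + 1) := by positivity
    have h5 : 0 ≤ x * (k + 1) := by positivity
    rw [hv]; nlinarith [sq_nonneg x]
  set M : Finset (α × α) :=
    ((N (k + 1)) ×ˢ (N k ∪ N (k + 1))).filter fun p => d p.1 p.2 ≤ r with hM
  have hsub : badEvent Z d δ N h x k ⊆ ⋃ p ∈ M, {ω | r * v ≤ |Z p.1 ω - Z p.2 ω|} := by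
    rintro ω ⟨s, hs, t, ht, hd, hlt⟩
    simp only [mem_iUnion]
    refine ⟨(s, t), ?_, ?_⟩
    · simp only [hM, Finset.mem_filter, Finset.mem_product, Finset.mem_union]
      exact ⟨⟨hs, ht⟩, hd⟩
    · exact (hlink ▸ hlt).le
  have hcard : (M.card : ℝ) ≤ 2 * Real.exp (2 * h (k + 1)) := by
    have h1 : M.card ≤ (N (k + 1)).card * ((N k).card + (N (k + 1)).card) :=
      (Finset.card_filter_le _ _).trans ((Finset.card_product _ _).le.trans
        (Nat.mul_le_mul_left _ (Finset.card_union_le _ _)))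
    have h2 : (M.card : ℝ) ≤ (N (k + 1)).card * ((N k).card + (N (k + 1)).card) := by
      exact_mod_cast h1
    have h3 := hN.card_le (k + 1)
    have h4 := (hN.card_le k).trans (Real.exp_le_exp.2 (hN.mono k.le_succ))
    calc (M.card : ℝ) ≤ (N (k + 1)).card * ((N k).card + (N (k + 1)).card) := h2
      _ ≤ Real.exp (h (k + 1)) * (Real.exp (h (k + 1)) + Real.exp (h (k + 1))) := by gcongr
      _ = 2 * Real.exp (2 * h (k + 1)) := by
        rw [two_mul (h (k + 1)), Real.exp_add]; ring
  have hone : ∀ p ∈ M, P {ω | r * v ≤ |Z p.1 ω - Z p.2 ω|} ≤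
      ENNReal.ofReal (2 * Real.exp (-(v ^ 2 / 2))) := by
    intro p hp
    simp only [hM, Finset.mem_filter, Finset.mem_product, Finset.mem_union] at hp
    have hp2 : p.2 ∈ T := hp.1.2.elim (fun q => hN.subset _ q) (fun q => hN.subset _ q)
    refine (hZ p.1 (hN.subset _ hp.1.1) p.2 hp2 r hr0 hp.2 (r * v) (by positivity)).trans_eq ?_
    congr 3
    field_simp
  calc P (badEvent Z d δ N h x k)
      ≤ ∑ p ∈ M, P {ω | r * v ≤ |Z p.1 ω - Z p.2 ω|} :=
        (measure_mono hsub).trans (measure_biUnion_finset_le _ _)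
    _ ≤ ∑ _p ∈ M, ENNReal.ofReal (2 * Real.exp (-(v ^ 2 / 2))) := Finset.sum_le_sum hone
    _ = ENNReal.ofReal (M.card * (2 * Real.exp (-(v ^ 2 / 2)))) := by
        rw [Finset.sum_const, nsmul_eq_mul, ENNReal.ofReal_mul (by positivity)]; simp
    _ ≤ ENNReal.ofReal (4 * (1 / 5) ^ (k + 1) * Real.exp (-x ^ 2)) := by
        refine ENNReal.ofReal_le_ofReal ?_
        have h5 : Real.exp (-2) ≤ 1 / 5 := by
          rw [Real.exp_neg, ← one_div]
          refine one_div_le_one_div_of_le (by norm_num) ?_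
          have := Real.exp_one_gt_d9
          rw [show (2 : ℝ) = 1 + 1 by norm_num, Real.exp_add]
          nlinarith
        have h6 : Real.exp (-(2 * ((k : ℝ) + 1))) ≤ (1 / 5) ^ (k + 1) := by
          have : Real.exp (-(2 * ((k : ℝ) + 1))) = Real.exp (-2) ^ (k + 1) := by
            rw [← Real.exp_nat_mul]; congr 1; push_cast; ring
          rw [this]
          gcongr
        calc (M.card : ℝ) * (2 * Real.exp (-(v ^ 2 / 2)))
            ≤ 2 * Real.exp (2 * h (k + 1)) *
              (2 * Real.exp (-(2 * h (k + 1) + x ^ 2 + 2 * (k + 1)))) := by gcongr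
          _ = 4 * Real.exp (-(2 * ((k : ℝ) + 1))) * Real.exp (-x ^ 2) := by
              have : Real.exp (2 * h (k + 1)) * Real.exp (-(2 * h (k + 1) + x ^ 2 + 2 * (k + 1)))
                  = Real.exp (-(2 * ((k : ℝ) + 1))) * Real.exp (-x ^ 2) := by
                rw [← Real.exp_add, ← Real.exp_add]; congr 1; ring
              linear_combination 4 * this
          _ ≤ _ := by gcongr

theorem tsum_measure_badEvent_le (hZ : HasSubgaussianIncrements Z T d P)
    (hN : IsDyadicNet T d δ J N h) (hx : 0 ≤ x) :
    ∑' k, P (badEvent Z d δ N h x k) ≤ ENNReal.ofReal (Real.exp (-x ^ 2)) := by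
  have hs : HasSum (fun k : ℕ => 4 * (1 / 5 : ℝ) ^ (k + 1) * Real.exp (-x ^ 2))
      (Real.exp (-x ^ 2)) := by
    have := (hasSum_geometric_of_lt_one (r := (1 / 5 : ℝ)) (by norm_num) (by norm_num)).mul_left
      (4 / 5 * Real.exp (-x ^ 2))
    rw [show 4 / 5 * Real.exp (-x ^ 2) * (1 - 1 / 5)⁻¹ = Real.exp (-x ^ 2) by norm_num; ring]
      at this
    refine this.congr_fun fun k => ?_
    ring
  refine (ENNReal.tsum_le_tsum fun k => measure_badEvent_le hZ hN hx k).trans_eq ?_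
  rw [← ENNReal.ofReal_tsum_of_nonneg (fun k => by positivity) hs.summable, hs.tsum_eq]

theorem sum_linkBound_le (hN : IsDyadicNet T d δ J N h) (hx : 0 ≤ x) (m : ℕ) :
    ∑ k ∈ Finset.range m, linkBound δ h x k ≤ 12 * J + 12 * δ * x + 24 * δ := by
  have hδ := hN.pos
  have h1 : ∑ k ∈ Finset.range m, δ * (1 / 2) ^ (k + 1) * √(h (k + 1)) ≤ J := by
    refine le_trans ?_ (hN.sum_le (m + 1))
    rw [Finset.sum_range_succ']
    have : 0 ≤ δ * (1 / 2) ^ 0 * √(h 0) := by positivity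
    linarith
  have h2 : ∑ k ∈ Finset.range m, (1 / 2 : ℝ) ^ k ≤ 2 := sum_geometric_two_le m
  have h3 : ∑ k ∈ Finset.range m, (1 / 2 : ℝ) ^ k * (k + 1) ≤ 4 := by
    have h4 : ∑ k ∈ Finset.range m, (1 / 2 : ℝ) ^ k * (k + 1) = 4 - (1 / 2) ^ m * (2 * m + 4) := by
      induction m with
      | zero => norm_num
      | succ m ih =>
        -- The facts `h1` and `h2` depend on `m`, so the induction hypothesis asks for them again at
        -- the smaller index.
        rw [Finset.sum_range_succ, ih (le_trans ?_ h1) (sum_geometric_two_le m)]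
        · push_cast; ring
        · rw [Finset.sum_range_succ]
          have : 0 ≤ δ * (1 / 2) ^ (m + 1) * √(h (m + 1)) := by positivity
          linarith
    have : 0 ≤ (1 / 2 : ℝ) ^ m * (2 * m + 4) := by positivity
    linarith
  have h5 : ∑ k ∈ Finset.range m, linkBound δ h x k =
      12 * ∑ k ∈ Finset.range m, δ * (1 / 2) ^ (k + 1) * √(h (k + 1)) +
      6 * δ * x * ∑ k ∈ Finset.range m, (1 / 2 : ℝ) ^ k +
      6 * δ * ∑ k ∈ Finset.range m, (1 / 2 : ℝ) ^ k * (k + 1) := by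
    rw [Finset.mul_sum, Finset.mul_sum, Finset.mul_sum, ← Finset.sum_add_distrib,
      ← Finset.sum_add_distrib]
    refine Finset.sum_congr rfl fun k _ => ?_
    unfold linkBound
    ring
  rw [h5]
  have h6 : 6 * δ * x * ∑ k ∈ Finset.range m, (1 / 2 : ℝ) ^ k ≤ 6 * δ * x * 2 := by gcongr
  have h7 : 6 * δ * ∑ k ∈ Finset.range m, (1 / 2 : ℝ) ^ k * (k + 1) ≤ 6 * δ * 4 := by gcongr
  linarith

theorem summable_linkBound (hN : IsDyadicNet T d δ J N h) (hx : 0 ≤ x) :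
    Summable (linkBound δ h x) :=
  summable_of_sum_range_le (linkBound_nonneg hN.pos.le hx) (sum_linkBound_le hN hx)

/-- Off the bad events, a point of `T` is almost surely controlled by its projections. -/
theorem ae_abs_sub_le_tsum (hd : IsPseudoDist d) (hZ : HasSubgaussianIncrements Z T d P)
    (hN : IsDyadicNet T d δ J N h) (hx : 0 ≤ x) {t : α} (ht : t ∈ T) {p : ℕ → α}
    (hp : ∀ k, p k ∈ N k ∧ d t (p k) ≤ δ * (1 / 2) ^ k) (m : ℕ) :
    ∀ᵐ ω ∂P, (∀ k, m ≤ k → ω ∉ badEvent Z d δ N h x k) →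
      |Z t ω - Z (p m) ω| ≤ ∑' k, linkBound δ h x (m + k) := by
  have hδ := hN.pos
  have hsummable : Summable fun k => linkBound δ h x (m + k) := by
    simpa only [add_comm m] using (summable_nat_add_iff m).2 (summable_linkBound hN hx)
  set S := ∑' k, linkBound δ h x (m + k) with hS
  have hchain : ∀ ω, (∀ k, m ≤ k → ω ∉ badEvent Z d δ N h x k) → ∀ j,
      |Z (p (m + j)) ω - Z (p m) ω| ≤ S := fun ω hω j =>
    (abs_chain_le hd hN hp hω j).trans
      (hsummable.sum_le_tsum _ fun k _ => linkBound_nonneg hδ.le hx _)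
  have hq : ∀ q : ℕ, ∀ᵐ ω ∂P, (∀ k, m ≤ k → ω ∉ badEvent Z d δ N h x k) →
      |Z t ω - Z (p m) ω| < S + 1 / ((q : ℝ) + 1) := by
    intro q
    set η : ℝ := 1 / ((q : ℝ) + 1) with hη
    have hη0 : 0 < η := by positivity
    rw [ae_iff, ← nonpos_iff_eq_zero]
    -- No path regularity is available here: `Z (p j)` tends to `Z t` only in probability. As the
    -- chain stays within `S` at every depth, an excess over `S + η` forces `η ≤ |Z t - Z (p (m +
    -- j))|` for all `j`, an event of vanishing probability by `exp (-y) ≤ 1 / y`.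
    have hlim : Tendsto (fun j : ℕ => ENNReal.ofReal (4 * (δ * (1 / 2) ^ (m + j)) ^ 2 / η ^ 2))
        atTop (𝓝 0) := by
      have h1 : Tendsto (fun j : ℕ => (1 / 2 : ℝ) ^ (m + j)) atTop (𝓝 0) := by
        have := (tendsto_add_atTop_iff_nat m).2
          (tendsto_pow_atTop_nhds_zero_of_lt_one (r := (1 / 2 : ℝ)) (by norm_num) (by norm_num))
        simpa only [add_comm m] using this
      have h2 : Tendsto (fun j : ℕ => 4 * (δ * (1 / 2 : ℝ) ^ (m + j)) ^ 2 / η ^ 2) atTop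
          (𝓝 (4 * (δ * 0) ^ 2 / η ^ 2)) :=
        (((h1.const_mul δ).pow 2).const_mul 4).div_const _
      simpa using ENNReal.tendsto_ofReal h2
    refine ge_of_tendsto' hlim fun j => ?_
    have hsub : {ω | ¬((∀ k, m ≤ k → ω ∉ badEvent Z d δ N h x k) →
        |Z t ω - Z (p m) ω| < S + η)} ⊆ {ω | η ≤ |Z t ω - Z (p (m + j)) ω|} := by
      intro ω hω
      simp only [mem_ofPred_eq, Classical.not_imp, not_lt] at hω ⊢
      have h1 := hchain ω hω.1 j
      have h2 := abs_sub_le (Z t ω) (Z (p (m + j)) ω) (Z (p m) ω)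
      linarith [hω.2]
    refine (measure_mono hsub).trans ((hZ t ht _ (hN.subset _ (hp (m + j)).1)
      (δ * (1 / 2) ^ (m + j)) (by positivity) (hp (m + j)).2 η hη0.le).trans
      (ENNReal.ofReal_le_ofReal ?_))
    set r := δ * (1 / 2) ^ (m + j) with hr
    have hr0 : 0 < r := by positivity
    set y := η ^ 2 / (2 * r ^ 2) with hy
    have hy0 : 0 < y := by positivity
    have h1 : Real.exp (-y) ≤ 1 / y := by
      rw [Real.exp_neg, ← one_div]
      exact one_div_le_one_div_of_le hy0 (by linarith [Real.add_one_le_exp y])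
    have h2 : -η ^ 2 / (2 * r ^ 2) = -y := by rw [hy]; ring
    rw [h2]
    calc 2 * Real.exp (-y) ≤ 2 * (1 / y) := by gcongr
      _ = 4 * r ^ 2 / η ^ 2 := by rw [hy]; field_simp; ring
  filter_upwards [ae_all_iff.2 hq] with ω hω hbad
  refine le_of_forall_pos_lt_add fun η hη => ?_
  obtain ⟨q, hq'⟩ := exists_nat_one_div_lt hη
  linarith [hω q hbad]

/-- **Chaining**: the deviation inequality for the supremum over a countable set. -/
theorem measure_exists_lt_abs_sub_le (hd : IsPseudoDist d) (hZ : HasSubgaussianIncrements Z T d P)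
    (hN : IsDyadicNet T d δ J N h) {t₀ : α} (hN₀ : N 0 = {t₀}) (hx : 0 ≤ x) {D : Set α}
    (hD : D.Countable) (hDT : D ⊆ T) :
    P {ω | ∃ t ∈ D, 12 * J + 12 * δ * x + 24 * δ < |Z t ω - Z t₀ ω|} ≤
      ENNReal.ofReal (Real.exp (-x ^ 2)) := by
  have hae : ∀ t ∈ D, ∀ᵐ ω ∂P, (∀ k, ω ∉ badEvent Z d δ N h x k) →
      |Z t ω - Z t₀ ω| ≤ 12 * J + 12 * δ * x + 24 * δ := by
    intro t ht
    choose p hp using fun k => hN.cover k t (hDT ht)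
    have hp0 : p 0 = t₀ := by simpa [hN₀] using (hp 0).1
    filter_upwards [ae_abs_sub_le_tsum hd hZ hN hx (hDT ht) hp 0] with ω hω hbad
    have h1 := hω fun k _ => hbad k
    rw [hp0] at h1
    refine h1.trans ?_
    simp only [zero_add]
    exact Real.tsum_le_of_sum_range_le (linkBound_nonneg hN.pos.le hx) (sum_linkBound_le hN hx)
  refine le_trans ?_ ((measure_iUnion_le _).trans (tsum_measure_badEvent_le hZ hN hx))
  refine measure_mono_ae ?_
  filter_upwards [(ae_ball_iff hD).2 hae] with ω hω hex
  obtain ⟨t, ht, hlt⟩ := hex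
  by_contra hbad
  have hbad' : ∀ k, ω ∉ badEvent Z d δ N h x k := fun k hk => hbad (mem_iUnion.2 ⟨k, hk⟩)
  exact absurd (hω t ht hbad') (not_le.2 hlt)

/-- **Dudley's continuity theorem**: a process with sub-Gaussian increments and finite entropy sum
is almost surely uniformly continuous on every countable set. -/
theorem ae_uniformContinuous_on_countable (hd : IsPseudoDist d)
    (hZ : HasSubgaussianIncrements Z T d P) (hN : IsDyadicNet T d δ J N h) {D : Set α}
    (hD : D.Countable) (hDT : D ⊆ T) :
    ∀ᵐ ω ∂P, ∀ η : ℝ, 0 < η → ∃ r : ℝ, 0 < r ∧ ∀ s ∈ D, ∀ t ∈ D, d s t < r →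
      |Z s ω - Z t ω| < η := by
  have hδ := hN.pos
  have hBC : ∀ᵐ ω ∂P, ∀ᶠ k in atTop, ω ∉ badEvent Z d δ N h 0 k :=
    ae_eventually_notMem
      (ne_top_of_le_ne_top ENNReal.ofReal_ne_top (tsum_measure_badEvent_le hZ hN le_rfl))
  have hcov : ∀ t, ∃ p : ℕ → α, t ∈ T → ∀ k, p k ∈ N k ∧ d t (p k) ≤ δ * (1 / 2) ^ k := by
    intro t
    by_cases ht : t ∈ T
    · choose p hp using fun k => hN.cover k t ht
      exact ⟨p, fun _ => hp⟩
    · exact ⟨fun _ => t, fun h => absurd h ht⟩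
  choose p hp using hcov
  have hae := (ae_ball_iff (μ := P) hD).2 fun t ht => ae_all_iff.2 fun m =>
    ae_abs_sub_le_tsum hd hZ hN le_rfl (hDT ht) (hp t (hDT ht)) m
  filter_upwards [hBC, hae] with ω hω hch η hη
  obtain ⟨m₀, hm₀⟩ := eventually_atTop.1 hω
  have htail : Tendsto (fun m => ∑' k, linkBound δ h 0 (m + k)) atTop (𝓝 0) := by
    simpa only [add_comm] using tendsto_sum_nat_add (linkBound δ h 0)
  have hlink : Tendsto (linkBound δ h 0) atTop (𝓝 0) :=
    (summable_linkBound hN le_rfl).tendsto_atTop_zero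
  obtain ⟨m, hm, h1, h2⟩ := ((eventually_ge_atTop m₀).and
    ((((tendsto_add_atTop_iff_nat 1).2 htail).eventually_lt_const (by positivity : 0 < η / 3)).and
      (hlink.eventually_lt_const (by positivity : 0 < η / 3)))).exists
  refine ⟨δ * (1 / 2) ^ m, by positivity, fun s hs t ht hst => ?_⟩
  have hbad : ∀ k, m + 1 ≤ k → ω ∉ badEvent Z d δ N h 0 k := fun k hk => hm₀ k (by omega)
  have hs1 := hch s hs (m + 1) hbad
  have ht1 := hch t ht (m + 1) hbad
  have hps := hp s (hDT hs) (m + 1)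
  have hpt := hp t (hDT ht) (m + 1)
  -- This needs the pairs inside a single net `N (m + 1)` that `badEvent` also includes. The
  -- projections are within `(1 / 2 + 1 + 1 / 2) δ 2⁻ᵐ`.
  have hmid : |Z (p s (m + 1)) ω - Z (p t (m + 1)) ω| ≤ linkBound δ h 0 m := by
    by_contra! hlt
    refine hm₀ m hm ⟨p s (m + 1), hps.1, p t (m + 1), Or.inr hpt.1, ?_, hlt⟩
    have e1 := hd.triangle (p s (m + 1)) s (p t (m + 1))
    have e2 := hd.triangle s t (p t (m + 1))
    rw [hd.symm _ s] at e1
    have e3 := hps.2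
    have e4 := hpt.2
    rw [pow_succ] at e3 e4
    have : 0 < δ * (1 / 2) ^ m := by positivity
    linarith
  have e1 := abs_sub_le (Z s ω) (Z (p s (m + 1)) ω) (Z t ω)
  have e2 := abs_sub_le (Z (p s (m + 1)) ω) (Z (p t (m + 1)) ω) (Z t ω)
  rw [abs_sub_comm (Z (p t (m + 1)) ω) (Z t ω)] at e2
  linarith

end Chaining

/-! ### From Gaussian tails to sub-Gaussian moment generating functions -/

section SubGaussian

variable {Ω : Type*} [MeasurableSpace Ω] {P : Measure Ω}

theorem integrableOn_and_integral_mul_exp_neg_sq_div_four :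
    IntegrableOn (fun t : ℝ => t * Real.exp (-t ^ 2 / 4)) (Ioi 0) ∧
      ∫ t in Ioi (0 : ℝ), t * Real.exp (-t ^ 2 / 4) = 2 := by
  have hderiv : ∀ t ∈ Ici (0 : ℝ), HasDerivAt (fun t : ℝ => -2 * Real.exp (-t ^ 2 / 4))
      (t * Real.exp (-t ^ 2 / 4)) t := by
    intro t _
    have h1 : HasDerivAt (fun t : ℝ => -t ^ 2 / 4) (-(2 * t) / 4) t := by
      simpa using ((hasDerivAt_pow 2 t).neg.div_const 4)
    exact (h1.exp.const_mul (-2)).congr_deriv (by ring)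
  have hpos : ∀ t ∈ Ioi (0 : ℝ), 0 ≤ t * Real.exp (-t ^ 2 / 4) := fun t ht =>
    mul_nonneg (le_of_lt ht) (Real.exp_pos _).le
  have hlim : Tendsto (fun t : ℝ => -2 * Real.exp (-t ^ 2 / 4)) atTop (𝓝 0) := by
    have h1 : Tendsto (fun t : ℝ => -t ^ 2 / 4) atTop atBot := by
      have h2 : Tendsto (fun t : ℝ => t ^ 2 * 4⁻¹) atTop atTop :=
        (tendsto_pow_atTop two_ne_zero).atTop_mul_const (by norm_num)
      refine (tendsto_neg_atTop_atBot.comp h2).congr fun t => ?_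
      simp only [Function.comp]
      ring
    simpa using (Real.tendsto_exp_atBot.comp h1).const_mul (-2)
  refine ⟨integrableOn_Ioi_deriv_of_nonneg' hderiv hpos hlim, ?_⟩
  rw [integral_Ioi_of_hasDerivAt_of_nonneg' hderiv hpos hlim]
  norm_num

/-- A nonnegative random variable with a Gaussian tail has an exponential square moment. -/
theorem integrable_exp_sq_of_tail [IsProbabilityMeasure P] {Z : Ω → ℝ} (hZ : Measurable Z)
    (hZ0 : ∀ ω, 0 ≤ Z ω)
    (htail : ∀ t : ℝ, 0 ≤ t → P.real {ω | t ≤ Z ω} ≤ 2 * Real.exp (-t ^ 2 / 2)) :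
    Integrable (fun ω => Real.exp (Z ω ^ 2 / 4)) P ∧ ∫ ω, Real.exp (Z ω ^ 2 / 4) ∂P ≤ 3 := by
  have hprim : ∀ z : ℝ, ∫ t in (0 : ℝ)..z, t / 2 * Real.exp (t ^ 2 / 4) =
      Real.exp (z ^ 2 / 4) - 1 := by
    intro z
    have hderiv : ∀ t : ℝ, HasDerivAt (fun t : ℝ => Real.exp (t ^ 2 / 4))
        (t / 2 * Real.exp (t ^ 2 / 4)) t := by
      intro t
      have h1 : HasDerivAt (fun t : ℝ => t ^ 2 / 4) (2 * t / 4) t := by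
        simpa using (hasDerivAt_pow 2 t).div_const 4
      exact h1.exp.congr_deriv (by ring)
    rw [intervalIntegral.integral_eq_sub_of_hasDerivAt (fun t _ => hderiv t)
      (Continuous.intervalIntegrable (by fun_prop) _ _)]
    simp
  -- Layer cake: `E exp (Z² / 4) - 1 = ∫ P(Z ≥ t) (t / 2) exp (t² / 4) dt`, and the tail bound
  -- leaves `∫ t exp (-t² / 4) dt = 2`.
  have hcake := lintegral_comp_eq_lintegral_meas_le_mul P (f := Z)
    (g := fun t => t / 2 * Real.exp (t ^ 2 / 4)) (ae_of_all _ hZ0) hZ.aemeasurable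
    (fun t _ => Continuous.intervalIntegrable (by fun_prop) _ _)
    ((ae_restrict_iff' measurableSet_Ioi).2 (ae_of_all _ fun t (ht : 0 < t) => by positivity))
  simp_rw [hprim] at hcake
  have hbound : ∫⁻ ω, ENNReal.ofReal (Real.exp (Z ω ^ 2 / 4) - 1) ∂P ≤ ENNReal.ofReal 2 := by
    obtain ⟨hi, hv⟩ := integrableOn_and_integral_mul_exp_neg_sq_div_four
    have h2 := ofReal_integral_eq_lintegral_ofReal hi
      ((ae_restrict_iff' measurableSet_Ioi).2 (ae_of_all _ fun t (ht : 0 < t) => by positivity))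
    rw [hv] at h2
    rw [hcake, h2]
    refine setLIntegral_mono' measurableSet_Ioi fun t (ht : 0 < t) => ?_
    have h1 : P {ω | t ≤ Z ω} ≤ ENNReal.ofReal (2 * Real.exp (-t ^ 2 / 2)) := by
      rw [← ofReal_measureReal]
      exact ENNReal.ofReal_le_ofReal (htail t ht.le)
    refine (mul_le_mul_left h1 _).trans_eq ?_
    rw [← ENNReal.ofReal_mul (by positivity)]
    congr 1
    have : Real.exp (-t ^ 2 / 2) * Real.exp (t ^ 2 / 4) = Real.exp (-t ^ 2 / 4) := by
      rw [← Real.exp_add]; congr 1; ring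
    linear_combination t * this
  have hnn : ∀ ω, 0 ≤ Real.exp (Z ω ^ 2 / 4) - 1 := fun ω => by
    have := Real.one_le_exp (x := Z ω ^ 2 / 4) (by positivity)
    linarith
  have hint : Integrable (fun ω => Real.exp (Z ω ^ 2 / 4) - 1) P := by
    refine ⟨by fun_prop, ?_⟩
    rw [hasFiniteIntegral_iff_ofReal (ae_of_all _ hnn)]
    exact hbound.trans_lt ENNReal.ofReal_lt_top
  have hint' : Integrable (fun ω => Real.exp (Z ω ^ 2 / 4)) P :=
    (hint.add (integrable_const (1 : ℝ))).congr (ae_of_all _ fun ω => by simp)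
  refine ⟨hint', ?_⟩
  have h2 : ∫ ω, (Real.exp (Z ω ^ 2 / 4) - 1) ∂P ≤ 2 := by
    rw [integral_eq_lintegral_of_nonneg_ae (ae_of_all _ hnn) hint.1]
    exact ENNReal.toReal_le_of_le_ofReal (by norm_num) hbound
  rw [integral_sub hint' (integrable_const _)] at h2
  simp at h2
  linarith

/-- The linear term disappears in expectation for a centred variable, which leaves only a square
exponential. -/
theorem exp_le_add_exp_sq (x : ℝ) : Real.exp x ≤ x + Real.exp (x ^ 2) := by
  have h2 := Real.add_one_le_exp (x ^ 2)
  rcases le_or_gt |x| 1 with h | h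
  · have h1 := (abs_le.1 (Real.abs_exp_sub_one_sub_id_le h)).2
    linarith
  rcases lt_abs.1 h with h | h
  · have : Real.exp x ≤ Real.exp (x ^ 2) := Real.exp_le_exp.2 (by nlinarith)
    linarith
  · have : Real.exp x ≤ 1 := Real.exp_le_one_iff.2 (by linarith)
    nlinarith

/-- Convexity between `0` and `z`; it scales the moment bound `3` at exponent `Z² / 4` down to `1 +
2p` at `p Z² / 4`. -/
theorem exp_mul_le_one_add_mul {p : ℝ} (hp0 : 0 ≤ p) (hp1 : p ≤ 1) (z : ℝ) :
    Real.exp (p * z) ≤ 1 + p * (Real.exp z - 1) := by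
  have := convexOn_exp.2 (mem_univ z) (mem_univ 0) hp0 (sub_nonneg.2 hp1) (by ring)
  simp at this
  linarith

/-- A centred random variable dominated by a variable with an exponential square moment is
sub-Gaussian. -/
theorem hasSubgaussianMGF_of_abs_le [IsProbabilityMeasure P] {X Z : Ω → ℝ} {a : ℝ≥0}
    (hX : Measurable X) (hXZ : ∀ ω, |X ω| ≤ a * Z ω) (hmean : ∫ ω, X ω ∂P = 0)
    (hint : Integrable (fun ω => Real.exp (Z ω ^ 2 / 4)) P)
    (hle : ∫ ω, Real.exp (Z ω ^ 2 / 4) ∂P ≤ 3) :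
    HasSubgaussianMGF X (16 * a ^ 2) P := by
  have ha : (0 : ℝ) ≤ a := a.coe_nonneg
  have hXint : Integrable X P := by
    refine (hint.const_mul a).mono' hX.aestronglyMeasurable (ae_of_all _ fun ω => ?_)
    rw [Real.norm_eq_abs]
    refine (hXZ ω).trans (mul_le_mul_of_nonneg_left ?_ ha)
    nlinarith [Real.add_one_le_exp (Z ω ^ 2 / 4), sq_nonneg (Z ω - 2)]
  have hexp : ∀ t : ℝ, Integrable (fun ω => Real.exp (t * X ω)) P := by
    intro t
    refine (hint.const_mul (Real.exp (t ^ 2 * a ^ 2))).mono'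
      (by fun_prop) (ae_of_all _ fun ω => ?_)
    rw [Real.norm_eq_abs, abs_of_pos (Real.exp_pos _), ← Real.exp_add]
    refine Real.exp_le_exp.2 ?_
    have h1 : t * X ω ≤ |t| * (a * Z ω) := (le_abs_self _).trans
      ((abs_mul _ _).le.trans (mul_le_mul_of_nonneg_left (hXZ ω) (abs_nonneg t)))
    have h2 := sq_abs t
    nlinarith [sq_nonneg (|t| * a - Z ω / 2)]
  refine ⟨hexp, fun t => ?_⟩
  have hsq : ∀ ω, X ω ^ 2 ≤ a ^ 2 * Z ω ^ 2 := fun ω => by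
    rw [← sq_abs, ← mul_pow]
    exact pow_le_pow_left₀ (abs_nonneg _) (hXZ ω) 2
  push_cast
  set p : ℝ := 4 * t ^ 2 * a ^ 2 with hp
  have hp0 : 0 ≤ p := by positivity
  have hgoal : 16 * (a : ℝ) ^ 2 * t ^ 2 / 2 = 2 * p := by rw [hp]; ring
  rw [hgoal]
  have hlin : ∀ q : ℝ, Integrable (fun ω => 1 + q * (Real.exp (Z ω ^ 2 / 4) - 1)) P ∧
      ∫ ω, (1 + q * (Real.exp (Z ω ^ 2 / 4) - 1)) ∂P =
        1 + q * (∫ ω, Real.exp (Z ω ^ 2 / 4) ∂P - 1) := by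
    intro q
    have h1 : Integrable (fun ω => q * (Real.exp (Z ω ^ 2 / 4) - 1)) P :=
      (hint.sub (integrable_const 1)).const_mul q
    refine ⟨(integrable_const 1).add h1, ?_⟩
    rw [integral_add (integrable_const 1) h1, integral_const_mul,
      integral_sub hint (integrable_const 1)]
    simp
  -- For `p ≤ 1` centredness is essential and gives `1 + 2p`. For `p > 1`, the inequality `t X ≤ p /
  -- 2 + Z² / 8` suffices, since the resulting factor `2` is at most `exp (3p / 2)`.
  rcases le_or_gt p 1 with hp1 | hp1
  · calc mgf X P t ≤ ∫ ω, (t * X ω + (1 + p * (Real.exp (Z ω ^ 2 / 4) - 1))) ∂P := by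
          refine integral_mono (hexp t) ((hXint.const_mul t).add (hlin p).1) fun ω => ?_
          refine (exp_le_add_exp_sq _).trans (add_le_add_right ?_ _)
          refine le_trans (Real.exp_le_exp.2 ?_) (exp_mul_le_one_add_mul hp0 hp1 _)
          rw [mul_pow, hp]
          nlinarith [mul_le_mul_of_nonneg_left (hsq ω) (sq_nonneg t)]
      _ = t * ∫ ω, X ω ∂P + (1 + p * (∫ ω, Real.exp (Z ω ^ 2 / 4) ∂P - 1)) := by
          rw [integral_add (hXint.const_mul t) (hlin p).1, integral_const_mul, (hlin p).2]
      _ ≤ 1 + 2 * p := by rw [hmean]; nlinarith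
      _ ≤ Real.exp (2 * p) := by linarith [Real.add_one_le_exp (2 * p)]
  · calc mgf X P t ≤ ∫ ω, Real.exp (p / 2) * (1 + 1 / 2 * (Real.exp (Z ω ^ 2 / 4) - 1)) ∂P := by
          refine integral_mono (hexp t) ((hlin (1 / 2)).1.const_mul _) fun ω => ?_
          have h1 : t * X ω ≤ |t| * (a * Z ω) := (le_abs_self _).trans
            ((abs_mul _ _).le.trans (mul_le_mul_of_nonneg_left (hXZ ω) (abs_nonneg t)))
          have h2 := sq_abs t
          have h3 : t * X ω ≤ p / 2 + 1 / 2 * (Z ω ^ 2 / 4) := by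
            rw [hp]
            nlinarith [sq_nonneg (|t| * a * 2 - Z ω / 2)]
          refine (Real.exp_le_exp.2 h3).trans ?_
          rw [Real.exp_add]
          exact mul_le_mul_of_nonneg_left
            (exp_mul_le_one_add_mul (by norm_num) (by norm_num) _) (Real.exp_pos _).le
      _ = Real.exp (p / 2) * (1 + 1 / 2 * (∫ ω, Real.exp (Z ω ^ 2 / 4) ∂P - 1)) := by
          rw [integral_const_mul, (hlin (1 / 2)).2]
      _ ≤ Real.exp (p / 2) * 2 := by
          refine mul_le_mul_of_nonneg_left ?_ (Real.exp_pos _).le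
          linarith
      _ ≤ Real.exp (p / 2) * Real.exp (3 / 2 * p) := by
          refine mul_le_mul_of_nonneg_left ?_ (Real.exp_pos _).le
          linarith [Real.add_one_le_exp (3 / 2 * p)]
      _ = Real.exp (2 * p) := by rw [← Real.exp_add]; congr 1; ring

/-- The two-sided tail bound of a sub-Gaussian random variable. -/
theorem measure_le_abs_le_of_hasSubgaussianMGF [IsProbabilityMeasure P] {X : Ω → ℝ} {c : ℝ≥0}
    (hX : HasSubgaussianMGF X c P) {r : ℝ} (hr : 0 < r) (hc : (c : ℝ) ≤ r ^ 2) {u : ℝ}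
    (hu : 0 ≤ u) :
    P {ω | u ≤ |X ω|} ≤ ENNReal.ofReal (2 * Real.exp (-u ^ 2 / (2 * r ^ 2))) := by
  have hr2 : (0 : ℝ) ≤ r ^ 2 := by positivity
  have hmono : ∀ {W : Ω → ℝ}, HasSubgaussianMGF W c P →
      HasSubgaussianMGF W ⟨r ^ 2, hr2⟩ P := fun hW =>
    ⟨hW.integrable_exp_mul, fun t => (hW.mgf_le t).trans (Real.exp_le_exp.2 (by
      have : (c : ℝ) * t ^ 2 ≤ r ^ 2 * t ^ 2 := by gcongr
      change _ ≤ r ^ 2 * t ^ 2 / 2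
      linarith))⟩
  have h1 := (hmono hX).measure_ge_le hu
  have h2 := (hmono hX.neg).measure_ge_le hu
  have hsub : {ω | u ≤ |X ω|} ⊆ {ω | u ≤ X ω} ∪ {ω | u ≤ (-X) ω} := fun ω hω => by
    rcases le_abs.1 (show u ≤ |X ω| from hω) with h | h
    · exact Or.inl h
    · exact Or.inr h
  rw [← ofReal_measureReal]
  refine ENNReal.ofReal_le_ofReal ?_
  refine (measureReal_mono hsub).trans ((measureReal_union_le _ _).trans ?_)
  change _ ≤ Real.exp (-u ^ 2 / (2 * r ^ 2)) at h1
  change _ ≤ Real.exp (-u ^ 2 / (2 * r ^ 2)) at h2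
  linarith

end SubGaussian

/-! ### Noise increments in the two models -/

section NoiseModels

variable {Ω : Type*} [MeasurableSpace Ω] {P : Measure Ω} [IsProbabilityMeasure P]
  {Y : Type*} [NormedAddCommGroup Y] [InnerProductSpace ℝ Y] {n : ℕ} {ε : Ω → Fin n → Y → ℝ}

/-- The increment is centred Gaussian, and expanding the covariance gives its variance `‖f - f'‖²`
without linearity of the paths in `f`. -/
theorem IsWhiteNoise.hasSubgaussianMGF_sub {W : Ω → Y → ℝ} (hW : IsWhiteNoise W P) (f f' : Y) :
    HasSubgaussianMGF (fun ω => W ω f - W ω f') (‖f - f'‖₊ ^ 2) P := by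
  have hlaw : HasGaussianLaw (fun ω => W ω f - W ω f') P := hW.gaussian.hasGaussianLaw_fun_sub
  have hL : ∀ g, MemLp (fun ω => W ω g) 2 P := fun g =>
    (hW.gaussian.hasGaussianLaw_eval g).memLp_two
  have hmean : ∫ ω, (W ω f - W ω f') ∂P = 0 := by
    rw [integral_sub ((hL f).integrable one_le_two) ((hL f').integrable one_le_two), hW.mean,
      hW.mean, sub_zero]
  have hvar : Var[fun ω => W ω f - W ω f'; P] = ‖f - f'‖ ^ 2 := by
    rw [← covariance_self hlaw.aemeasurable,
      covariance_fun_sub_fun_sub (hL f) (hL f') (hL f) (hL f'), hW.cov, hW.cov, hW.cov, hW.cov,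
      ← real_inner_self_eq_norm_sq, inner_sub_left, inner_sub_right, inner_sub_right]
    ring
  have hmap := hlaw.map_eq_gaussianReal
  rw [hmean, hvar] at hmap
  refine ⟨fun t => ?_, fun t => ?_⟩
  · have h1 := integrable_exp_mul_gaussianReal (μ := 0) (v := (‖f - f'‖ ^ 2).toNNReal) t
    rw [← hmap, integrable_map_measure (by fun_prop) hlaw.aemeasurable] at h1
    exact h1
  · rw [mgf_gaussianReal hmap]
    refine Real.exp_le_exp.2 (le_of_eq ?_)
    rw [Real.coe_toNNReal _ (by positivity)]
    simp

variable [CompleteSpace Y] [MeasurableSpace Y] [BorelSpace Y]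

/-- By Cauchy–Schwarz the inner product is dominated by `‖f‖ ‖e‖`, and `‖e‖` has an exponential
square moment by its tail. -/
theorem IsSubGaussian.hasSubgaussianMGF_inner {e : Ω → Y}
    [TopologicalSpace.SeparableSpace Y] (he : IsSubGaussian e 1 P) (f : Y) :
    HasSubgaussianMGF (fun ω => ⟪e ω, f⟫) (16 * ‖f‖₊ ^ 2) P := by
  obtain ⟨hi, hle⟩ := integrable_exp_sq_of_tail (P := P) (Z := fun ω => ‖e ω‖) he.measurable.norm
    (fun ω => norm_nonneg _) (fun t ht => by simpa using he.tail t ht)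
  have heint : Integrable e P := by
    refine hi.mono' he.measurable.aestronglyMeasurable (ae_of_all _ fun ω => ?_)
    nlinarith [Real.add_one_le_exp (‖e ω‖ ^ 2 / 4), sq_nonneg (‖e ω‖ - 2)]
  refine hasSubgaussianMGF_of_abs_le (Z := fun ω => ‖e ω‖) (he.measurable.inner measurable_const)
    (fun ω => ?_) ?_ hi hle
  · rw [coe_nnnorm, mul_comm]
    exact abs_real_inner_le_norm _ _
  · simp_rw [real_inner_comm f]
    rw [integral_inner heint f, he.mean, inner_zero_right]

/-- In both noise models the increments of `v ↦ ∑ᵢ εᵢ(vᵢ)` are sub-Gaussian. -/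
theorem hasSubgaussianMGF_sum_noise_sub [TopologicalSpace.SeparableSpace Y]
    (hε : IsWhiteNoiseModel ε P ∨ IsSubGaussianModel ε P) (v w : Fin n → Y) :
    HasSubgaussianMGF (fun ω => ∑ i, (ε ω i (v i) - ε ω i (w i)))
      (∑ i, 16 * ‖v i - w i‖₊ ^ 2) P := by
  rcases hε with hε | ⟨e, he, hind, heq⟩
  · refine HasSubgaussianMGF.sum_of_iIndepFun (X := fun i ω => ε ω i (v i) - ε ω i (w i)) ?_
      fun i _ => ?_
    · exact hε.indep.comp (fun i (y : Y → ℝ) => y (v i) - y (w i)) fun i => by fun_prop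
    -- The Gaussian proxy is weakened by `16` so that both models share one constant.
    · have h := (hε.whiteNoise i).hasSubgaussianMGF_sub (v i) (w i)
      refine ⟨h.integrable_exp_mul, fun t => (h.mgf_le t).trans (Real.exp_le_exp.2 ?_)⟩
      push_cast
      nlinarith [mul_nonneg (sq_nonneg ‖v i - w i‖) (sq_nonneg t)]
  · simp_rw [heq, ← inner_sub_right]
    refine HasSubgaussianMGF.sum_of_iIndepFun (X := fun i ω => ⟪e i ω, v i - w i⟫) ?_
      fun i _ => (he i).hasSubgaussianMGF_inner _
    exact hind.comp (fun i (y : Y) => ⟪y, v i - w i⟫) fun i => by fun_prop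

end NoiseModels

/-! ### Measurable selection of minimizers -/

section MeasurableArgmin

/-- A dense countable set detects the values of a continuous function from above. -/
theorem exists_mem_lt_of_dense {S : Type*} [TopologicalSpace S] {D : Set S} (hD : Dense D)
    {f : S → ℝ} (hf : Continuous f) {s : S} {b : ℝ} (hs : f s < b) : ∃ t ∈ D, f t < b := by
  obtain ⟨t, ht, htD⟩ := hD.exists_mem_open (isOpen_lt hf continuous_const) ⟨s, hs⟩
  exact ⟨t, ht, htD⟩

/-- Whether a Carathéodory function attains its minimum on a closed set is a measurable event. -/
theorem measurableSet_exists_minimizer_mem {Ω S : Type*} [MeasurableSpace Ω] [TopologicalSpace S]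
    [CompactSpace S] [SecondCountableTopology S] [Nonempty S] {f : Ω → S → ℝ}
    (hmeas : ∀ s, Measurable fun ω => f ω s) (hcont : ∀ ω, Continuous (f ω)) {C : Set S}
    (hC : IsClosed C) : MeasurableSet {ω | ∃ s ∈ C, ∀ s', f ω s ≤ f ω s'} := by
  obtain ⟨D, hDc, hD⟩ := TopologicalSpace.exists_countable_dense S
  obtain ⟨D', hDc', hD'⟩ := TopologicalSpace.exists_countable_dense C
  -- By compactness of `C`, a minimizer lies in `C` exactly when the infimum over `C` does not
  -- exceed the infimum over the whole space; dense countable sets detect both.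
  have heq : {ω | ∃ s ∈ C, ∀ s', f ω s ≤ f ω s'} =
      ⋂ t ∈ D, ⋂ q : ℕ, ⋃ s ∈ D', {ω | f ω (s : S) < f ω t + 1 / ((q : ℝ) + 1)} := by
    ext ω
    simp only [mem_ofPred_eq, mem_iInter, mem_iUnion, exists_prop]
    constructor
    · rintro ⟨s, hs, hmin⟩ t _ q
      refine exists_mem_lt_of_dense hD' ((hcont ω).comp continuous_subtype_val) (s := ⟨s, hs⟩) ?_
      have : (0 : ℝ) < 1 / ((q : ℝ) + 1) := by positivity
      simp only [Function.comp]
      linarith [hmin t]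
    · intro h
      have hne : C.Nonempty := by
        obtain ⟨t, ht⟩ := hD.nonempty
        obtain ⟨s, -, -⟩ := h t ht 0
        exact ⟨s, s.2⟩
      obtain ⟨s₀, hs₀, hmin⟩ := hC.isCompact.exists_isMinOn hne (hcont ω).continuousOn
      refine ⟨s₀, hs₀, fun s' => ?_⟩
      by_contra! hlt
      obtain ⟨t, ht, htlt⟩ := exists_mem_lt_of_dense hD (hcont ω) hlt
      obtain ⟨q, hq⟩ := exists_nat_one_div_lt (sub_pos.2 htlt)
      obtain ⟨s, -, hs⟩ := h t ht q
      have : f ω s₀ ≤ f ω s := hmin s.2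
      linarith
  rw [heq]
  exact MeasurableSet.biInter hDc fun t _ => MeasurableSet.iInter fun q =>
    MeasurableSet.biUnion hDc' fun s _ => measurableSet_lt (hmeas _) ((hmeas _).add_const _)

/-- **Measurable selection of minimizers** of a Carathéodory function on a compact set. -/
theorem exists_measurable_isMinOn {Ω E : Type*} [MeasurableSpace Ω] [MetricSpace E]
    [MeasurableSpace E] [BorelSpace E] {K : Set E} (hK : IsCompact K) (hne : K.Nonempty)
    {F : Ω → E → ℝ} (hmeas : ∀ g ∈ K, Measurable fun ω => F ω g)
    (hcont : ∀ ω, ContinuousOn (F ω) K) :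
    ∃ G : Ω → E, Measurable G ∧ ∀ ω, G ω ∈ K ∧ IsMinOn (F ω) K (G ω) := by
  have : CompactSpace K := isCompact_iff_compactSpace.1 hK
  have : Nonempty K := hne.to_subtype
  -- The Cantor set supplies a linear order: its closed set of minimizing parameters has a least
  -- element, a canonical choice. That choice is at most `a` iff some minimizer lies in the closed
  -- set of parameters `≤ a`.
  obtain ⟨φ₀, hφ₀, hsurj₀⟩ := exists_nat_bool_continuous_surjective_of_compact K
  let φ : cantorSet → K := fun s => φ₀ (cantorSetHomeomorphNatToBool s)
  have hφ : Continuous φ := hφ₀.comp cantorSetHomeomorphNatToBool.continuous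
  have hsurj : Function.Surjective φ := hsurj₀.comp cantorSetHomeomorphNatToBool.surjective
  have : CompactSpace cantorSet := cantorSetHomeomorphNatToBool.symm.compactSpace
  have : Nonempty cantorSet := cantorSetHomeomorphNatToBool.toEquiv.nonempty
  let f : Ω → cantorSet → ℝ := fun ω s => F ω (φ s)
  have hfm : ∀ s, Measurable fun ω => f ω s := fun s => hmeas _ (φ s).2
  have hfc : ∀ ω, Continuous (f ω) := fun ω =>
    (continuousOn_iff_continuous_domRestrict.1 (hcont ω)).comp hφ
  have hleast : ∀ ω, ∃ s, IsLeast {s | ∀ s', f ω s ≤ f ω s'} s := by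
    intro ω
    obtain ⟨s, -, hs⟩ := isCompact_univ.exists_isMinOn univ_nonempty (hfc ω).continuousOn
    refine IsCompact.exists_isLeast (IsClosed.isCompact ?_) ⟨s, fun s' => hs (mem_univ s')⟩
    simp only [ofPred_forall]
    exact isClosed_iInter fun s' => isClosed_le (hfc ω) continuous_const
  choose τ hτ using hleast
  have hτm : Measurable τ := by
    have h1 : Measurable fun ω => (τ ω : ℝ) := by
      refine measurable_of_Iic fun a => ?_
      have heq : (fun ω => (τ ω : ℝ)) ⁻¹' Iic a =
          {ω | ∃ s ∈ {s : cantorSet | (s : ℝ) ≤ a}, ∀ s', f ω s ≤ f ω s'} := by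
        ext ω
        constructor
        · intro h
          exact ⟨τ ω, h, (hτ ω).1⟩
        · rintro ⟨s, hs, hmin⟩
          exact le_trans (Subtype.coe_le_coe.2 ((hτ ω).2 hmin)) hs
      rw [heq]
      exact measurableSet_exists_minimizer_mem hfm hfc
        (isClosed_le continuous_subtype_val continuous_const)
    exact h1.subtype_mk
  refine ⟨fun ω => φ (τ ω), (continuous_subtype_val.comp hφ).measurable.comp hτm,
    fun ω => ⟨(φ (τ ω)).2, fun g hg => ?_⟩⟩
  obtain ⟨s, hs⟩ := hsurj ⟨g, hg⟩
  have := (hτ ω).1 s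
  simp only [f, hs] at this
  exact this

end MeasurableArgmin

/-! ### Continuous versions of processes -/

section ContinuousVersion

/-- A process that is almost surely uniformly continuous on every countable subset of `S` has a
version whose sample paths are continuous on `S`. -/
theorem exists_continuousOn_version {Ω M : Type*} [MeasurableSpace Ω] {P : Measure Ω}
    [PseudoMetricSpace M] [SecondCountableTopology M] {S : Set M} {W : M → Ω → ℝ}
    (hW : ∀ f, Measurable (W f))
    (hUC : ∀ D : Set M, D.Countable → D ⊆ S → ∀ᵐ ω ∂P, ∀ η : ℝ, 0 < η → ∃ r : ℝ, 0 < r ∧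
      ∀ s ∈ D, ∀ t ∈ D, dist s t < r → |W s ω - W t ω| < η) :
    ∃ W' : M → Ω → ℝ, (∀ f, Measurable (W' f)) ∧ (∀ f, W' f =ᵐ[P] W f) ∧
      ∀ ω, ContinuousOn (fun f => W' f ω) S := by
  classical
  obtain ⟨D₀, hD₀c, hD₀⟩ := TopologicalSpace.exists_countable_dense S
  set D : Set M := Subtype.val '' D₀ with hD
  have hDc : D.Countable := hD₀c.image _
  have hDS : D ⊆ S := by rintro _ ⟨s, -, rfl⟩; exact s.2
  have hseq : ∀ f, ∃ u : ℕ → M, f ∈ S → (∀ j, u j ∈ D) ∧ Tendsto u atTop (𝓝 f) := by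
    intro f
    by_cases hf : f ∈ S
    · obtain ⟨u, hu, hlim⟩ := mem_closure_iff_seq_limit.1 (hD₀ ⟨f, hf⟩)
      exact ⟨fun j => u j, fun _ => ⟨fun j => ⟨u j, hu j, rfl⟩,
        (continuous_subtype_val.tendsto _).comp hlim⟩⟩
    · exact ⟨fun _ => f, fun h => absurd h hf⟩
  choose u hu using hseq
  set U : Set Ω := {ω | ∀ q : ℕ, ∃ p : ℕ, ∀ s ∈ D, ∀ t ∈ D, dist s t < 1 / ((p : ℝ) + 1) →
    |W s ω - W t ω| < 1 / ((q : ℝ) + 1)} with hU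
  have hUm : MeasurableSet U := by
    have : U = ⋂ q : ℕ, ⋃ p : ℕ, ⋂ s ∈ D, ⋂ t ∈ D, {ω | dist s t < 1 / ((p : ℝ) + 1) →
        |W s ω - W t ω| < 1 / ((q : ℝ) + 1)} := by
      ext ω; simp [hU]
    rw [this]
    refine MeasurableSet.iInter fun q => MeasurableSet.iUnion fun p =>
      MeasurableSet.biInter hDc fun s _ => MeasurableSet.biInter hDc fun t _ => ?_
    by_cases hst : dist s t < 1 / ((p : ℝ) + 1)
    · simp only [hst, true_imp_iff]
      exact measurableSet_lt ((hW s).sub (hW t)).abs measurable_const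
    · simp only [hst, false_imp_iff]
      exact MeasurableSet.univ
  have hmod : ∀ ω ∈ U, ∀ η : ℝ, 0 < η → ∃ r : ℝ, 0 < r ∧ ∀ s ∈ D, ∀ t ∈ D, dist s t < r →
      |W s ω - W t ω| < η := by
    intro ω hω η hη
    obtain ⟨q, hq⟩ := exists_nat_one_div_lt hη
    obtain ⟨p, hp⟩ := hω q
    exact ⟨_, by positivity, fun s hs t ht hst => (hp s hs t ht hst).trans hq⟩
  have hlim : ∀ f ∈ S, ∀ ω ∈ U, ∃ l, Tendsto (fun j => W (u f j) ω) atTop (𝓝 l) := by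
    intro f hf ω hω
    refine cauchySeq_tendsto_of_complete (Metric.cauchySeq_iff.2 fun η hη => ?_)
    obtain ⟨r, hr, hr'⟩ := hmod ω hω η hη
    obtain ⟨j₀, hj₀⟩ := Metric.cauchySeq_iff.1 (hu f hf).2.cauchySeq r hr
    exact ⟨j₀, fun a ha b hb => hr' _ ((hu f hf).1 a) _ ((hu f hf).1 b) (hj₀ a ha b hb)⟩
  choose! l hl using hlim
  -- Extension by limits from `D` on the event of uniform continuity, zero off it; outside `S` the
  -- process is kept.
  let W' : M → Ω → ℝ := fun f ω => if f ∈ S then (if ω ∈ U then l f ω else 0) else W f ω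
  refine ⟨W', fun f => ?_, fun f => ?_, fun ω => ?_⟩
  · by_cases hf : f ∈ S
    · refine measurable_of_tendsto_metrizable
        (f := fun j ω => if ω ∈ U then W (u f j) ω else 0)
        (fun j => Measurable.ite hUm (hW _) measurable_const) (tendsto_pi_nhds.2 fun ω => ?_)
      by_cases hω : ω ∈ U
      · simpa [W', hf, hω] using hl f hf ω hω
      · simp [W', hf, hω]
    · simpa [W', hf] using hW f
  · by_cases hf : f ∈ S
    -- Adjoining `f` to `D` identifies the limit along `D` with the original value almost surely.
    · filter_upwards [hUC (insert f D) (hDc.insert f) (insert_subset hf hDS)] with ω hω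
      have hωU : ω ∈ U := by
        intro q
        obtain ⟨r, hr, hr'⟩ := hω (1 / ((q : ℝ) + 1)) (by positivity)
        obtain ⟨p, hp⟩ := exists_nat_one_div_lt hr
        exact ⟨p, fun s hs t ht hst =>
          hr' s (mem_insert_of_mem _ hs) t (mem_insert_of_mem _ ht) (hst.trans hp)⟩
      have hconv : Tendsto (fun j => W (u f j) ω) atTop (𝓝 (W f ω)) := by
        refine Metric.tendsto_atTop.2 fun η hη => ?_
        obtain ⟨r, hr, hr'⟩ := hω η hη
        obtain ⟨j₀, hj₀⟩ := Metric.tendsto_atTop.1 (hu f hf).2 r hr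
        exact ⟨j₀, fun j hj => hr' _ (mem_insert_of_mem _ ((hu f hf).1 j)) _
          (mem_insert f D) (hj₀ j hj)⟩
      simp only [W', hf, hωU, if_true]
      exact tendsto_nhds_unique (hl f hf ω hωU) hconv
    · exact Eventually.of_forall fun ω => by simp [W', hf]
  · by_cases hω : ω ∈ U
    · refine Metric.continuousOn_iff.2 fun g hg η hη => ?_
      obtain ⟨r, hr, hr'⟩ := hmod ω hω (η / 2) (by positivity)
      refine ⟨r, hr, fun f hf hfg => ?_⟩
      have h1 : Tendsto (fun j => |W (u f j) ω - W (u g j) ω|) atTop (𝓝 |l f ω - l g ω|) :=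
        ((hl f hf ω hω).sub (hl g hg ω hω)).abs
      have h2 : ∀ᶠ j in atTop, dist (u f j) (u g j) < r :=
        ((hu f hf).2.dist (hu g hg).2).eventually_lt_const hfg
      have h3 : |l f ω - l g ω| ≤ η / 2 := by
        refine le_of_tendsto h1 (h2.mono fun j hj => ?_)
        exact (hr' _ ((hu f hf).1 j) _ ((hu g hg).1 j) hj).le
      simp only [W', hf, hg, hω, if_true, Real.dist_eq]
      linarith
    · refine (continuousOn_const (c := (0 : ℝ))).congr fun f hf => ?_
      simp [W', hf, hω]

end ContinuousVersion

/-! ### The empirical seminorm -/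

section EmpiricalNorm

variable {X Y : Type*} [NormedAddCommGroup Y] {n : ℕ} {x : Fin n → X}

theorem empNorm_nonneg (x : Fin n → X) (G : X → Y) : 0 ≤ empNorm x G := Real.sqrt_nonneg _

theorem sum_norm_sq_eq (hn : 0 < n) (x : Fin n → X) (G : X → Y) :
    ∑ i, ‖G (x i)‖ ^ 2 = n * empNorm x G ^ 2 := by
  have hn' : (0 : ℝ) < n := by exact_mod_cast hn
  rw [empNorm, Real.sq_sqrt (by positivity)]
  field_simp

/-- A rescaled `ℓ²` norm of the values at the design, from which the triangle inequality is
inherited. -/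
theorem empNorm_eq_mul_norm_toLp (x : Fin n → X) (G : X → Y) :
    empNorm x G = √(1 / (n : ℝ)) * ‖WithLp.toLp 2 fun i => G (x i)‖ := by
  rw [empNorm, Real.sqrt_mul (by positivity), PiLp.norm_eq_of_L2]

theorem empNorm_add_le (x : Fin n → X) (G H : X → Y) :
    empNorm x (G + H) ≤ empNorm x G + empNorm x H := by
  simp only [empNorm_eq_mul_norm_toLp]
  rw [← mul_add]
  refine mul_le_mul_of_nonneg_left ?_ (Real.sqrt_nonneg _)
  exact norm_add_le (WithLp.toLp 2 fun i => G (x i)) (WithLp.toLp 2 fun i => H (x i))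

theorem empNorm_sub_comm (x : Fin n → X) (G H : X → Y) :
    empNorm x (G - H) = empNorm x (H - G) := by
  simp only [empNorm, Pi.sub_apply, norm_sub_rev]

theorem isPseudoDist_empNorm (x : Fin n → X) :
    IsPseudoDist fun G H : X → Y => empNorm x (G - H) where
  symm := empNorm_sub_comm x
  triangle F G H := by
    have := empNorm_add_le x (F - G) (G - H)
    rwa [sub_add_sub_cancel] at this

theorem norm_apply_le_sqrt_mul_empNorm (hn : 0 < n) (x : Fin n → X) (G : X → Y) (i : Fin n) :
    ‖G (x i)‖ ≤ √n * empNorm x G := by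
  refine (pow_le_pow_iff_left₀ (norm_nonneg _) ?_ two_ne_zero).1 ?_
  · exact mul_nonneg (Real.sqrt_nonneg _) (empNorm_nonneg x G)
  rw [mul_pow, Real.sq_sqrt (by positivity), ← sum_norm_sq_eq hn]
  exact Finset.single_le_sum (f := fun i => ‖G (x i)‖ ^ 2) (fun i _ => by positivity)
    (Finset.mem_univ i)

/-- Evaluation at a design point is continuous for a norm that dominates the empirical norm. -/
theorem continuous_eval_of_empNorm_le {E : Type*} [NormedAddCommGroup E] [NormedSpace ℝ E]
    [NormedSpace ℝ Y] (hn : 0 < n) {ι : E →ₗ[ℝ] (X → Y)} {A : ℝ}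
    (hA : ∀ g, empNorm x (ι g) ≤ A * ‖g‖) (i : Fin n) :
    Continuous fun g => ι g (x i) := by
  refine AddMonoidHomClass.continuous_of_bound ((LinearMap.proj (x i)).comp ι) (√n * A) fun g => ?_
  refine (norm_apply_le_sqrt_mul_empNorm hn x (ι g) i).trans ?_
  rw [mul_assoc]
  exact mul_le_mul_of_nonneg_left (hA g) (Real.sqrt_nonneg _)

end EmpiricalNorm

/-- Nets for the class induce nets for its values at a design point. -/
theorem IsDyadicNet.eval {X Y : Type*} [NormedAddCommGroup Y] {n : ℕ} {x : Fin n → X}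
    {T : Set (X → Y)} {δ J : ℝ} {N : ℕ → Finset (X → Y)}
    {h : ℕ → ℝ} [DecidableEq Y] (hN : IsDyadicNet T (fun G H => empNorm x (G - H)) δ J N h)
    (hn : 0 < n) (i : Fin n) :
    IsDyadicNet ((fun G => G (x i)) '' T) dist (√n * δ) (√n * J)
      (fun k => (N k).image fun G => G (x i)) h where
  pos := mul_pos (Real.sqrt_pos.2 (by exact_mod_cast hn)) hN.pos
  subset k := by
    rw [Finset.coe_image]
    exact image_mono (hN.subset k)
  cover k := by
    rintro _ ⟨G, hG, rfl⟩
    obtain ⟨H, hH, hd⟩ := hN.cover k G hG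
    refine ⟨H (x i), Finset.mem_image_of_mem _ hH, ?_⟩
    rw [dist_eq_norm, mul_assoc]
    exact (norm_apply_le_sqrt_mul_empNorm hn x (G - H) i).trans
      (mul_le_mul_of_nonneg_left hd (Real.sqrt_nonneg _))
  card_le k := le_trans (by exact_mod_cast Finset.card_image_le) (hN.card_le k)
  nonneg := hN.nonneg
  mono := hN.mono
  sum_le m := by
    simp only [mul_assoc]
    rw [← Finset.mul_sum]
    refine mul_le_mul_of_nonneg_left ?_ (Real.sqrt_nonneg _)
    simpa only [mul_assoc] using hN.sum_le m

variable {X Y E Ω : Type*} [NormedAddCommGroup Y] [InnerProductSpace ℝ Y] {n : ℕ}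
  [NormedAddCommGroup E] [NormedSpace ℝ E] {x : Fin n → X} {ι : E →ₗ[ℝ] (X → Y)} {K : Set E}

/-! ### White noise with continuous sample paths -/

section WhiteNoiseVersion

variable [MeasurableSpace Ω] {P : Measure Ω}

theorem IsWhiteNoise.congr {W W' : Ω → Y → ℝ} (hW : IsWhiteNoise W P)
    (hm : ∀ f, Measurable fun ω => W' ω f) (h : ∀ f, ∀ᵐ ω ∂P, W' ω f = W ω f) :
    IsWhiteNoise W' P where
  measurable := hm
  gaussian := hW.gaussian.congr fun f => (h f).mono fun _ hω => hω.symm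
  mean f := (integral_congr_ae (h f)).trans (hW.mean f)
  cov f f' := by
    rw [← hW.cov f f', covariance, covariance, integral_congr_ae (h f), integral_congr_ae (h f')]
    refine integral_congr_ae ?_
    filter_upwards [h f, h f'] with ω h1 h2
    rw [h1, h2]

theorem IsWhiteNoise.hasSubgaussianIncrements [IsProbabilityMeasure P] {W : Ω → Y → ℝ}
    (hW : IsWhiteNoise W P) (S : Set Y) :
    HasSubgaussianIncrements (fun f ω => W ω f) S dist P := by
  intro f _ f' _ r hr hd u hu
  refine measure_le_abs_le_of_hasSubgaussianMGF (hW.hasSubgaussianMGF_sub f f') hr ?_ hu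
  rw [dist_eq_norm] at hd
  push_cast
  exact pow_le_pow_left₀ (norm_nonneg _) hd 2

/-- A white noise model has a version whose sample paths are continuous on a compact class with
finite entropy integrals. -/
theorem IsWhiteNoiseModel.exists_continuous_version [IsProbabilityMeasure P]
    [TopologicalSpace.SeparableSpace Y] {ε : Ω → Fin n → Y → ℝ} (hε : IsWhiteNoiseModel ε P)
    (hn : 0 < n) (hK : IsCompact K) {gs : E} (hgs : gs ∈ K) {A : ℝ} (hA₀ : 0 < A)
    (hA : ∀ g, empNorm x (ι g) ≤ A * ‖g‖)
    (hJ : ∀ δ, 0 < δ → entropyIntegral x (ι '' K) (ι gs) δ ≠ ⊤) :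
    ∃ ε' : Ω → Fin n → Y → ℝ, IsWhiteNoiseModel ε' P ∧
      (∀ i f, ∀ᵐ ω ∂P, ε' ω i f = ε ω i f) ∧ ∀ ω, ContinuousOnClass x ι K (ε' ω) := by
  classical
  have : SecondCountableTopology Y := UniformSpace.secondCountable_of_separable Y
  obtain ⟨b, hb⟩ := hK.isBounded.exists_norm_le
  have hb₀ : 0 ≤ b := (norm_nonneg _).trans (hb gs hgs)
  -- This radius exceeds the distance from `gs` to any point of the bounded set `K`, so localization
  -- is vacuous; the `+ 1` covers `b = 0`.
  set δ : ℝ := A * (2 * b) + 1 with hδ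
  have hδ₀ : 0 < δ := by positivity
  have hlocal : localClass x (ι '' K) (ι gs) δ = ι '' K := by
    refine Subset.antisymm (fun G hG => hG.1) ?_
    rintro _ ⟨g, hg, rfl⟩
    refine ⟨mem_image_of_mem _ hg, ?_⟩
    rw [← map_sub]
    refine (hA _).trans ?_
    have h1 : ‖g - gs‖ ≤ 2 * b := (norm_sub_le _ _).trans (by linarith [hb g hg, hb gs hgs])
    have := mul_le_mul_of_nonneg_left h1 hA₀.le
    linarith
  obtain ⟨N, h, hN, -⟩ := exists_isDyadicNet (T := localClass x (ι '' K) (ι gs) δ)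
    (d := fun G H => empNorm x (G - H)) (t₀ := ι gs) hδ₀
    (ENNReal.toReal_nonneg (a := entropyIntegral x (ι '' K) (ι gs) δ))
    (hlocal.ge (mem_image_of_mem _ hgs)) (fun G hG => hG.2) (ENNReal.ofReal_toReal (hJ δ hδ₀)).ge
  rw [hlocal] at hN
  have hver : ∀ i, ∃ W' : Y → Ω → ℝ, (∀ f, Measurable (W' f)) ∧
      (∀ f, W' f =ᵐ[P] fun ω => ε ω i f) ∧
      ∀ ω, ContinuousOn (fun f => W' f ω) ((fun G : X → Y => G (x i)) '' (ι '' K)) := fun i =>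
    exists_continuousOn_version (W := fun f ω => ε ω i f) (hε.whiteNoise i).measurable
      fun D hD hDS => ae_uniformContinuous_on_countable ⟨dist_comm, dist_triangle⟩
        ((hε.whiteNoise i).hasSubgaussianIncrements _) (hN.eval hn i) hD hDS
  choose W' hm hae hc using hver
  refine ⟨fun ω i f => W' i f ω, ⟨fun i => ?_, ?_⟩, hae, fun ω i => ?_⟩
  · exact (hε.whiteNoise i).congr (hm i) (hae i)
  -- The exceptional null sets depend on `f`, but independence of processes is determined by
  -- finite-dimensional distributions.
  · exact iIndepFun.process_congr (X := fun i f ω => ε ω i f) (X' := W') hε.indep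
      fun i f => (hae i f).symm
  · exact (hc i ω).comp (continuous_eval_of_empNorm_le hn hA i).continuousOn
      fun g hg => mem_image_of_mem _ (mem_image_of_mem _ hg)

end WhiteNoiseVersion

/-! ### The empirical risk and its minimizers -/

section EmpiricalRisk

theorem continuousOnClass_of_isSubGaussianModel [MeasurableSpace Ω] {P : Measure Ω}
    [MeasurableSpace Y] {ε : Ω → Fin n → Y → ℝ} (hε : IsSubGaussianModel ε P) (hn : 0 < n) {A : ℝ}
    (hA : ∀ g, empNorm x (ι g) ≤ A * ‖g‖) (ω : Ω) : ContinuousOnClass x ι K (ε ω) := by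
  obtain ⟨e, -, -, heq⟩ := hε
  intro i
  simp_rw [heq]
  exact (continuous_const.inner (continuous_eval_of_empNorm_le hn hA i)).continuousOn

theorem continuousOn_empRisk (hn : 0 < n) {A : ℝ} (hA : ∀ g, empNorm x (ι g) ≤ A * ‖g‖)
    {w : Fin n → Y → ℝ} (hw : ContinuousOnClass x ι K w) (G₀ : X → Y) (σ : ℝ) :
    ContinuousOn (fun g => empRisk x (observation x G₀ σ w) (ι g)) K := by
  have hev : ∀ i, ContinuousOn (fun g => ι g (x i)) K := fun i =>
    (continuous_eval_of_empNorm_le hn hA i).continuousOn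
  refine continuousOn_const.mul (continuousOn_finsetSum _ fun i _ => ?_)
  exact (continuousOn_const.mul ((continuousOn_const.inner (hev i)).add
    (continuousOn_const.mul (hw i)))).add ((hev i).norm.pow 2)

/-- Minimizers of the empirical risk can be selected measurably in the data. -/
theorem exists_measurable_isMinOn_empRisk [MeasurableSpace E] [BorelSpace E] (hn : 0 < n)
    (hK : IsCompact K) (hne : K.Nonempty) {A : ℝ} (hA : ∀ g, empNorm x (ι g) ≤ A * ‖g‖)
    {ε : Ω → Fin n → Y → ℝ} (hε : ∀ ω, ContinuousOnClass x ι K (ε ω)) (G₀ : X → Y) (σ : ℝ) :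
    ∃ Ghat : Ω → E, Measurable[dataSigma fun ω => observation x G₀ σ (ε ω)] Ghat ∧
      ∀ ω, Ghat ω ∈ K ∧
        IsMinOn (fun g => empRisk x (observation x G₀ σ (ε ω)) (ι g)) K (Ghat ω) := by
  -- Running the selection theorem with the data `σ`-algebra on `Ω` makes the minimizer a function
  -- measurable in the data.
  let : MeasurableSpace Ω := dataSigma fun ω => observation x G₀ σ (ε ω)
  refine exists_measurable_isMinOn hK hne (fun g _ => ?_)
    fun ω => continuousOn_empRisk hn hA (hε ω) G₀ σ
  have h1 : Measurable fun y : Fin n → Y → ℝ => empRisk x y (ι g) := by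
    unfold empRisk
    fun_prop
  exact h1.comp (comap_measurable _)

/-- Completing the square separates the loss relative to `G₀` from the noise. -/
theorem empRisk_observation (hn : 0 < n) (G₀ : X → Y) (σ : ℝ) (w : Fin n → Y → ℝ) (G : X → Y) :
    empRisk x (observation x G₀ σ w) G =
      empNorm x (G - G₀) ^ 2 - empNorm x G₀ ^ 2 - 2 * σ / n * ∑ i, w i (G (x i)) := by
  have hn' : (0 : ℝ) < n := by exact_mod_cast hn
  have h1 := sum_norm_sq_eq hn x (G - G₀)
  have h2 := sum_norm_sq_eq hn x G₀
  have h3 : ∑ i, (-2 * observation x G₀ σ w i (G (x i)) + ‖G (x i)‖ ^ 2) =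
      ∑ i, ‖(G - G₀) (x i)‖ ^ 2 - ∑ i, ‖G₀ (x i)‖ ^ 2 - 2 * σ * ∑ i, w i (G (x i)) := by
    rw [Finset.mul_sum, ← Finset.sum_sub_distrib, ← Finset.sum_sub_distrib]
    refine Finset.sum_congr rfl fun i _ => ?_
    rw [Pi.sub_apply, norm_sub_sq_real, real_inner_comm, observation]
    ring
  rw [empRisk, h3, h1, h2]
  field_simp

/-- The basic inequality for a minimizer of the empirical risk. -/
theorem basic_inequality (hn : 0 < n) (G₀ : X → Y) (σ : ℝ) {w : Fin n → Y → ℝ} {G Gs : X → Y}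
    (h : empRisk x (observation x G₀ σ w) G ≤ empRisk x (observation x G₀ σ w) Gs) :
    n * (empNorm x (G - G₀) ^ 2 - empNorm x (Gs - G₀) ^ 2) ≤
      2 * σ * ∑ i, (w i (G (x i)) - w i (Gs (x i))) := by
  have hn' : (0 : ℝ) < n := by exact_mod_cast hn
  rw [empRisk_observation hn, empRisk_observation hn] at h
  rw [Finset.sum_sub_distrib]
  have h1 := mul_le_mul_of_nonneg_left h hn'.le
  have h2 : ∀ s : ℝ, (n : ℝ) * (2 * σ / n * s) = 2 * σ * s := fun s => by field_simp
  simp only [mul_sub, h2] at h1 ⊢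
  linarith

end EmpiricalRisk

/-! ### Deviation inequality, peeling and concentration -/

section Concentration

variable [MeasurableSpace Ω] {P : Measure Ω} [IsProbabilityMeasure P] [CompleteSpace Y]
  [TopologicalSpace.SeparableSpace Y] [MeasurableSpace Y] [BorelSpace Y] {ε : Ω → Fin n → Y → ℝ}

/-- The variance proxy of the increment is `16 n ‖G - H‖ₙ²`, which division by `4√n` normalizes. -/
theorem hasSubgaussianIncrements_noise (hε : IsWhiteNoiseModel ε P ∨ IsSubGaussianModel ε P)
    (hn : 0 < n) (T : Set (X → Y)) :
    HasSubgaussianIncrements (fun G ω => (∑ i, ε ω i (G (x i))) / (4 * √n)) T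
      (fun G H => empNorm x (G - H)) P := by
  have hn' : (0 : ℝ) < n := by exact_mod_cast hn
  have hs : 0 < √(n : ℝ) := Real.sqrt_pos.2 hn'
  intro G _ H _ r hr hd u hu
  have hmgf := hasSubgaussianMGF_sum_noise_sub hε (fun i => G (x i)) fun i => H (x i)
  have htail := measure_le_abs_le_of_hasSubgaussianMGF hmgf (r := 4 * √n * r) (by positivity) ?_
    (u := 4 * √n * u) (by positivity)
  · refine le_trans (measure_mono fun ω hω => ?_) (htail.trans_eq ?_)
    · simp only [mem_ofPred_eq] at hω ⊢
      rw [← sub_div, ← Finset.sum_sub_distrib, abs_div,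
        abs_of_pos (by positivity : 0 < 4 * √(n : ℝ)), le_div_iff₀ (by positivity)] at hω
      linarith
    · congr 3
      field_simp
  · have h1 := sum_norm_sq_eq hn x (G - H)
    push_cast
    rw [← Finset.mul_sum]
    simp only [Pi.sub_apply] at h1
    rw [h1, mul_pow, mul_pow, Real.sq_sqrt hn'.le]
    have h2 : empNorm x (G - H) ^ 2 ≤ r ^ 2 := pow_le_pow_left₀ (empNorm_nonneg _ _) hd 2
    nlinarith [mul_le_mul_of_nonneg_left h2 hn'.le]

/-- The deviation inequality for the noise over a localized class. -/
theorem measure_exists_large_noise_increment_le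
    (hε : IsWhiteNoiseModel ε P ∨ IsSubGaussianModel ε P)
    (hcont : ∀ᵐ ω ∂P, ContinuousOnClass x ι K (ε ω)) (hn : 0 < n) (hK : IsCompact K) {gs : E}
    (hgs : gs ∈ K) {δ J t : ℝ} (hδ : 0 < δ) (hJ : 0 ≤ J) (ht : 0 ≤ t)
    (hint : entropyIntegral x (ι '' K) (ι gs) δ ≤ ENNReal.ofReal J) :
    P {ω | ∃ g ∈ K, empNorm x (ι g - ι gs) ≤ δ ∧ 4 * √n * (24 * J + 12 * δ * t + 24 * δ) <
      |∑ i, (ε ω i (ι g (x i)) - ε ω i (ι gs (x i)))|} ≤ ENNReal.ofReal (Real.exp (-t ^ 2)) := by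
  have hn' : (0 : ℝ) < n := by exact_mod_cast hn
  have hs : 0 < √(n : ℝ) := Real.sqrt_pos.2 hn'
  have hgs' : ι gs ∈ localClass x (ι '' K) (ι gs) δ := by
    refine ⟨mem_image_of_mem _ hgs, ?_⟩
    simpa [empNorm] using hδ.le
  -- The entropy sum of this net is bounded by `2 * J`, so `12 * (2 * J)` gives the `24 * J` of the
  -- threshold.
  obtain ⟨N, h, hN, hN₀⟩ := exists_isDyadicNet (d := fun G H => empNorm x (G - H)) hδ hJ hgs'
    (fun G hG => hG.2) hint
  set T : Set E := {g | g ∈ K ∧ empNorm x (ι g - ι gs) ≤ δ} with hT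
  obtain ⟨D, hDT, hDc, hDd⟩ :=
    (hK.isSeparable.mono fun g (hg : g ∈ T) => hg.1).exists_countable_dense_subset
  have hmain := measure_exists_lt_abs_sub_le (isPseudoDist_empNorm x)
    (hasSubgaussianIncrements_noise hε hn (localClass x (ι '' K) (ι gs) δ)) hN hN₀ ht
    (hDc.image ι) (by
      rintro _ ⟨g, hg, rfl⟩
      exact ⟨mem_image_of_mem _ (hDT hg).1, (hDT hg).2⟩)
  refine le_trans (measure_mono_ae ?_) hmain
  filter_upwards [hcont] with ω hω hex
  obtain ⟨g, hgK, hgδ, hlt⟩ := hex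
  have hc : ContinuousOn (fun g => |∑ i, (ε ω i (ι g (x i)) - ε ω i (ι gs (x i)))|) K :=
    (continuousOn_finsetSum _ fun i _ => (hω i).sub continuousOn_const).abs
  have hcl : g ∈ closure D := hDd ⟨hgK, hgδ⟩
  have : (𝓝[D] g).NeBot := mem_closure_iff_nhdsWithin_neBot.1 hcl
  -- A strict excess at `g` persists nearby, hence at a point of the countable dense set.
  have hev := ((hc g hgK).mono fun g hg => (hDT hg).1).eventually_const_lt hlt
  obtain ⟨g', hg', hg'D⟩ := (hev.and self_mem_nhdsWithin).exists
  refine ⟨ι g', mem_image_of_mem _ hg'D, ?_⟩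
  rw [← sub_div, ← Finset.sum_sub_distrib, abs_div, abs_of_pos (by positivity : 0 < 4 * √(n : ℝ)),
    lt_div_iff₀ (by positivity)]
  linarith

/-- Since `2 ^ (s + 1) ≥ s + 1` and `u ≥ 1`, the squared level is at least `u² + s`; the shells then
sum geometrically. -/
theorem exp_neg_sq_two_pow_mul_le {u : ℝ} (hu1 : 1 ≤ u) (s : ℕ) :
    Real.exp (-(2 ^ (s + 1) * u) ^ 2) ≤ Real.exp (-u ^ 2) * (1 / 2) ^ s := by
  have h1 : Real.exp (-1) ≤ 1 / 2 := by
    rw [Real.exp_neg, ← one_div]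
    exact one_div_le_one_div_of_le (by norm_num) (by linarith [Real.add_one_le_exp 1])
  have h2 : Real.exp (-(s : ℝ)) ≤ (1 / 2) ^ s := by
    have : Real.exp (-(s : ℝ)) = Real.exp (-1) ^ s := by
      rw [← Real.exp_nat_mul]; congr 1; ring
    rw [this]
    gcongr
  refine le_trans ?_ (mul_le_mul_of_nonneg_left h2 (Real.exp_pos _).le)
  rw [← Real.exp_add]
  refine Real.exp_le_exp.2 ?_
  have h3 : (s : ℝ) + 1 ≤ 2 ^ (s + 1) := by exact_mod_cast Nat.lt_two_pow_self.le
  have hs0 : (0 : ℝ) ≤ s := s.cast_nonneg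
  have h4 : ((s : ℝ) + 1) ^ 2 ≤ (2 ^ (s + 1)) ^ 2 := by gcongr
  have hu3 : 1 ≤ u ^ 2 := by nlinarith
  rw [mul_pow]
  have h5 : ((s : ℝ) + 1) ^ 2 * u ^ 2 ≤ (2 ^ (s + 1)) ^ 2 * u ^ 2 := by gcongr
  nlinarith [mul_le_mul_of_nonneg_left hu3 hs0, mul_nonneg (sq_nonneg (s : ℝ)) (sq_nonneg u)]

/-- Here `m` is `√n` and `t ≥ 1` absorbs the term without `t`. All terms become multiples of `m² r²
/ (C σ)` with total factor `243`, so `C > 972` is what is needed. -/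
theorem peeling_threshold_lt {m C σ r ψ t : ℝ} (hC : 1000 ≤ C) (hm : 0 < m) (hσ : 0 < σ)
    (hr : 0 < r) (hψ : ψ ≤ 9 * r ^ 2 * m / (32 * C * σ)) (ht : t = m * r / (2 * C * σ))
    (ht1 : 1 ≤ t) :
    4 * m * (24 * ψ + 12 * (3 * r) * t + 24 * (3 * r)) < m ^ 2 * r ^ 2 / (4 * σ) := by
  have hC₀ : 0 < C := by linarith
  have hrt : r ≤ r * t := le_mul_of_one_le_right hr.le ht1
  calc 4 * m * (24 * ψ + 12 * (3 * r) * t + 24 * (3 * r))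
      ≤ 4 * m * (24 * (9 * r ^ 2 * m / (32 * C * σ)) + 108 * (r * t)) := by
        refine mul_le_mul_of_nonneg_left ?_ (by positivity)
        linarith
    _ = 243 * (m ^ 2 * r ^ 2) / (C * σ) := by
        rw [ht]
        field_simp
        ring
    _ < m ^ 2 * r ^ 2 / (4 * σ) := by
        rw [div_lt_div_iff₀ (by positivity) (by positivity)]
        have h1 : 0 < m ^ 2 * r ^ 2 * σ := by positivity
        nlinarith

/-- The concentration inequality for minimizers of the empirical risk. -/
theorem measureReal_empNorm_sub_ge_le (hε : IsWhiteNoiseModel ε P ∨ IsSubGaussianModel ε P)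
    (hcont : ∀ᵐ ω ∂P, ContinuousOnClass x ι K (ε ω)) (hn : 0 < n) (hK : IsCompact K) {gs : E}
    (hgs : gs ∈ K) {Ψ : ℝ → ℝ} (hΨ₀ : ∀ δ, 0 < δ → 0 ≤ Ψ δ)
    (hΨ : ∀ δ, 0 < δ → entropyIntegral x (ι '' K) (ι gs) δ ≤ ENNReal.ofReal (Ψ δ))
    (hΨanti : AntitoneOn (fun δ => Ψ δ / δ ^ 2) (Ioi 0)) {σ : ℝ} (hσ : 0 < σ) {G₀ : X → Y}
    {Ghat : Ω → E} (hmin : ∀ᵐ ω ∂P, Ghat ω ∈ K ∧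
      IsMinOn (fun g => empRisk x (observation x G₀ σ (ε ω)) (ι g)) K (Ghat ω))
    {C : ℝ} (hC : 1000 ≤ C) {δ : ℝ} (hδ : 0 < δ) (hδΨ : 32 * C * σ * Ψ δ ≤ √n * δ ^ 2) {R : ℝ}
    (hRδ : δ ≤ R) (hRn : 4 * C * σ / √n ≤ R) (hRs : √2 * empNorm x (ι gs - G₀) ≤ R) :
    P.real {ω | R ≤ empNorm x (ι (Ghat ω) - G₀)} ≤
      2 * Real.exp (-(n * R ^ 2) / (16 * C ^ 2 * σ ^ 2)) := by
  have hn' : (0 : ℝ) < n := by exact_mod_cast hn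
  have hs : 0 < √(n : ℝ) := Real.sqrt_pos.2 hn'
  have hss : √(n : ℝ) * √n = n := Real.mul_self_sqrt hn'.le
  have hC₀ : 0 < C := by linarith
  have hR : 0 < R := hδ.trans_le hRδ
  -- Chosen so that `exp (-u²)` is the exponential of the claim; the lower bound on `R` in terms of
  -- `1 / √n` says `1 ≤ u`.
  set u : ℝ := √n * R / (4 * C * σ) with hu
  have hu1 : 1 ≤ u := by
    rw [hu, le_div_iff₀ (by positivity), one_mul]
    rw [div_le_iff₀ hs] at hRn
    linarith
  have hu2 : -(n * R ^ 2) / (16 * C ^ 2 * σ ^ 2) = -u ^ 2 := by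
    rw [hu, div_pow, mul_pow, Real.sq_sqrt hn'.le]
    ring
  rw [hu2]
  let B : ℕ → Set Ω := fun s => {ω | ∃ g ∈ K, empNorm x (ι g - ι gs) ≤ 3 * (2 ^ s * R) ∧
    4 * √n * (24 * Ψ (3 * (2 ^ s * R)) + 12 * (3 * (2 ^ s * R)) * (2 ^ (s + 1) * u) +
      24 * (3 * (2 ^ s * R))) < |∑ i, (ε ω i (ι g (x i)) - ε ω i (ι gs (x i)))|}
  have hB : ∀ s, P (B s) ≤ ENNReal.ofReal (Real.exp (-u ^ 2) * (1 / 2) ^ s) := by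
    intro s
    have hpos : 0 < 3 * (2 ^ s * R) := by positivity
    refine (measure_exists_large_noise_increment_le hε hcont hn hK hgs hpos (hΨ₀ _ hpos)
      (by positivity) (hΨ _ hpos)).trans (ENNReal.ofReal_le_ofReal ?_)
    exact exp_neg_sq_two_pow_mul_le hu1 s
  have hsub : ∀ᵐ ω ∂P, R ≤ empNorm x (ι (Ghat ω) - G₀) → ω ∈ ⋃ s, B s := by
    filter_upwards [hmin] with ω ⟨hGK, hGmin⟩ hge
    set a := empNorm x (ι (Ghat ω) - G₀) with ha
    set b := empNorm x (ι gs - G₀) with hb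
    have hb₀ : 0 ≤ b := empNorm_nonneg _ _
    have hb2 : 2 * b ^ 2 ≤ R ^ 2 := by
      have := pow_le_pow_left₀ (by positivity) hRs 2
      rwa [mul_pow, Real.sq_sqrt (by norm_num)] at this
    have hbR : b ≤ R := by nlinarith
    obtain ⟨s, hs1, hs2⟩ := exists_nat_pow_near ((one_le_div hR).2 hge) (one_lt_two (α := ℝ))
    rw [le_div_iff₀ hR] at hs1
    rw [div_lt_iff₀ hR, pow_succ, mul_right_comm] at hs2
    set r : ℝ := 2 ^ s * R with hr
    have hRr : R ≤ r := le_mul_of_one_le_left hR.le (one_le_pow₀ one_le_two)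
    have hr₀ : 0 < r := hR.trans_le hRr
    refine mem_iUnion.2 ⟨s, Ghat ω, hGK, ?_, ?_⟩
    · have h1 := (isPseudoDist_empNorm x).triangle (ι (Ghat ω)) G₀ (ι gs)
      rw [empNorm_sub_comm x G₀ (ι gs)] at h1
      refine h1.trans ?_
      change a + b ≤ 3 * r
      linarith
    · have hbasic := basic_inequality hn G₀ σ (hGmin hgs)
      -- From `a ≥ r` and `b² ≤ R² / 2 ≤ r² / 2`.
      have hr2 : r ^ 2 / 2 ≤ a ^ 2 - b ^ 2 := by nlinarith
      have hlow : n * r ^ 2 / (4 * σ) ≤ ∑ i, (ε ω i (ι (Ghat ω) (x i)) - ε ω i (ι gs (x i))) := by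
        rw [div_le_iff₀ (by positivity)]
        nlinarith [mul_le_mul_of_nonneg_left hr2 hn'.le]
      refine lt_of_lt_of_le ?_ (hlow.trans (le_abs_self _))
      -- As `δ ≤ 3 * r`, monotonicity of `Ψ δ / δ²` transfers the condition from `δ` to this radius.
      have hΨr : Ψ (3 * r) ≤ 9 * r ^ 2 * √n / (32 * C * σ) := by
        have h1 : Ψ (3 * r) / (3 * r) ^ 2 ≤ Ψ δ / δ ^ 2 :=
          hΨanti hδ (show 0 < 3 * r by positivity) (by linarith)
        have h2 : Ψ δ / δ ^ 2 ≤ √n / (32 * C * σ) := by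
          rw [div_le_div_iff₀ (by positivity) (by positivity)]
          linarith
        have h3 := h1.trans h2
        rw [div_le_iff₀ (by positivity)] at h3
        refine h3.trans_eq ?_
        ring
      set t : ℝ := 2 ^ (s + 1) * u with ht
      have ht1 : 1 ≤ t := one_le_mul_of_one_le_of_one_le (one_le_pow₀ one_le_two) hu1
      have ht2 : t = √n * r / (2 * C * σ) := by
        rw [ht, hu, hr, pow_succ]
        field_simp
        ring
      have := peeling_threshold_lt hC hs hσ hr₀ hΨr ht2 ht1
      rwa [Real.sq_sqrt hn'.le] at this
  have hgeo : ∑' s : ℕ, ENNReal.ofReal (Real.exp (-u ^ 2) * (1 / 2) ^ s) =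
      ENNReal.ofReal (2 * Real.exp (-u ^ 2)) := by
    rw [← ENNReal.ofReal_tsum_of_nonneg (fun s => by positivity)
      (summable_geometric_two.mul_left _), tsum_mul_left, tsum_geometric_two, mul_comm]
  refine ENNReal.toReal_le_of_le_ofReal (by positivity) ?_
  rw [← hgeo]
  exact (measure_mono_ae hsub).trans ((measure_iUnion_le _).trans (ENNReal.tsum_le_tsum hB))

end Concentration

end HilbertRegression

end

theorem mainTheorem3 :
    ∃ C : ℝ, 0 < C ∧
      -- separable Hilbert spaces `X`, `Y`
      ∀ (X : Type*) [NormedAddCommGroup X] [InnerProductSpace ℝ X] [CompleteSpace X]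
        [TopologicalSpace.SeparableSpace X] [MeasurableSpace X] [BorelSpace X]
        (Y : Type*) [NormedAddCommGroup Y] [InnerProductSpace ℝ Y] [CompleteSpace Y]
        [TopologicalSpace.SeparableSpace Y] [MeasurableSpace Y] [BorelSpace Y]
        -- a linear space of maps `X → Y` with a norm: `E`, embedded by `ι`
        (E : Type*) [NormedAddCommGroup E] [NormedSpace ℝ E] [MeasurableSpace E] [BorelSpace E]
        (ι : E →ₗ[ℝ] (X → Y)) (_ : Function.Injective ι)
        (Ω : Type*) [MeasurableSpace Ω] (P : Measure Ω) [IsProbabilityMeasure P]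
        (n : ℕ) (_ : 0 < n) (x : Fin n → X) (σ : ℝ) (_ : 0 < σ)
        (G₀ : X → Y) (_ : Measurable G₀)
        -- the class `𝒢 = ι '' K` of measurable maps, and `G* = ι gs` in it
        (K : Set E) (_ : ∀ g ∈ K, Measurable (ι g)) (gs : E) (_ : gs ∈ K)
        -- (a) compactness in a norm that dominates the empirical seminorm
        (_ : IsCompact K) (A : ℝ) (_ : 0 < A)
        (_ : ∀ g : E, empNorm x (ι g) ≤ A * ‖g‖)
        -- (b) the bound on the entropy integral
        (Ψ : ℝ → ℝ) (_ : ∀ δ, 0 < δ → 0 ≤ Ψ δ)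
        (_ : ∀ δ, 0 < δ →
          entropyIntegral x (ι '' K) (ι gs) δ ≤ ENNReal.ofReal (Ψ δ))
        (_ : AntitoneOn (fun δ => Ψ δ / δ ^ 2) (Ioi 0))
        (ε : Ω → Fin n → Y → ℝ),
        -- (i) white noise has a version with continuous sample paths on the class
        (IsWhiteNoiseModel ε P →
          ∃ ε' : Ω → Fin n → Y → ℝ, IsWhiteNoiseModel ε' P ∧
            (∀ i f, ∀ᵐ ω ∂P, ε' ω i f = ε ω i f) ∧
            ∀ ω, ContinuousOnClass x ι K (ε' ω)) ∧
        -- (i) minimizers of the empirical risk can be selected measurably in the data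
        ((IsWhiteNoiseModel ε P ∧
              ∀ ω, ContinuousOnClass x ι K (ε ω)) ∨
            IsSubGaussianModel ε P →
          ∃ Ghat : Ω → E,
            Measurable[dataSigma
              fun ω => observation x G₀ σ (ε ω)] Ghat ∧
            ∀ ω, Ghat ω ∈ K ∧
              IsMinOn (fun g => empRisk x
                (observation x G₀ σ (ε ω)) (ι g)) K (Ghat ω)) ∧
        -- (ii) the concentration inequality, for every measurable selection of minimizers
        ((IsWhiteNoiseModel ε P ∧
              ∀ᵐ ω ∂P, ContinuousOnClass x ι K (ε ω)) ∨
            IsSubGaussianModel ε P →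
          ∀ Ghat : Ω → E, Measurable Ghat →
            (∀ᵐ ω ∂P, Ghat ω ∈ K ∧
              IsMinOn (fun g => empRisk x
                (observation x G₀ σ (ε ω)) (ι g)) K (Ghat ω)) →
            ∀ δ : ℝ, 0 < δ → 32 * C * σ * Ψ δ ≤ √(n : ℝ) * δ ^ 2 →
            ∀ R : ℝ,
              max δ (max (4 * C * σ / √(n : ℝ))
                (√2 * empNorm x (ι gs - G₀))) ≤ R →
              P.real {ω | R ≤ empNorm x (ι (Ghat ω) - G₀)} ≤
                2 * Real.exp (-(n * R ^ 2) / (16 * C ^ 2 * σ ^ 2))) := by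
  refine ⟨1000, by norm_num, ?_⟩
  intro X _ _ _ _ _ _ Y _ _ _ _ _ _ E _ _ _ _ ι _ Ω _ P _ n hn x σ hσ G₀ _ K _ gs hgs hK A hA₀ hA
    Ψ hΨ₀ hΨ hΨanti ε
  refine ⟨fun hε => ?_, fun hε => ?_, fun hε Ghat _ hmin δ hδ hδΨ R hR => ?_⟩
  · exact hε.exists_continuous_version hn hK hgs hA₀ hA
      fun δ hδ => ne_top_of_le_ne_top ENNReal.ofReal_ne_top (hΨ δ hδ)
  · refine exists_measurable_isMinOn_empRisk hn hK ⟨gs, hgs⟩ hA (fun ω => ?_) G₀ σ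
    exact hε.elim (fun h => h.2 ω) fun h => continuousOnClass_of_isSubGaussianModel h hn hA ω
  · obtain ⟨hRδ, hR'⟩ := max_le_iff.1 hR
    obtain ⟨hRn, hRs⟩ := max_le_iff.1 hR'
    refine measureReal_empNorm_sub_ge_le (hε.imp_left And.left) ?_ hn hK hgs hΨ₀ hΨ hΨanti hσ hmin
      le_rfl hδ hδΨ hRδ hRn hRs
    exact hε.elim And.right
      fun h => Filter.Eventually.of_forall (continuousOnClass_of_isSubGaussianModel h hn hA)
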